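/- **Conventions.** A represented space $\mathbf X$ is a set together with a partial surjection $\delta_{\mathbf X} :\subseteq \mathbb N^{\mathbb N}\to \mathbf X$; $p$ is a name of $\delta_{\mathbf X}(p)$. A problem $f:\subseteq\mathbf X\rightrightarrows\mathbf Y$ is a partial multivalued function between represented spaces, with $\operatorname{dom}(f)=\{x\mid f(x)\neq\emptyset\}$. A multivalued function is computable with domain $D$ if some computable partial function on $\mathbb N^{\mathbb N}$ maps every name of every $x\in D$ to a name of some value at $x$. For $p\in\mathbb N^{\mathbb N}$, let $p-1$ be the sequence obtained by deleting all zeros of $p$ and decreasing the other entries by one. The completion $\overline{\mathbf Y}=\mathbf Y\cup\{\bot\}$ has the total representation in which $p$ names $\delta_{\mathbf Y}(p-1)$ if this is defined and $\bot$ otherwise. In $\overline{\mathbf Y}^{*}$, a name of a finite sequence gives first its length and then names of the members; in $\overline{\mathbf Y}^{<\omega}$, a name gives names of the members together with a sequence of natural numbers whose maximum is the length. A problem $f:\subseteq\mathbf X\rightrightarrows\mathbf Y$ is *$k$-guessable*, respectively *finitely guessable*, respectively *eventually-finitely guessable*, if the following task is computable with domain $\operatorname{dom}(f)$: given $x$,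 produce an element of $\overline{\mathbf Y}^{k}$, respectively $\overline{\mathbf Y}^{*}$, respectively $\overline{\mathbf Y}^{<\omega}$, at least one member of which belongs to $f(x)$. For problems $f:\subseteq\mathbf X\rightrightarrows\mathbf Y$ and $g:\subseteq\mathbf Z\rightrightarrows\mathbf W$, the *compositional product* $f\star g$ (first $g$, then $f$) is represented by the following problem. An instance is a pair $(a,c)$ with $c\in\operatorname{dom}(g)$ and $a\in\mathbb N^{\mathbb N}$ the code of a partial continuous function $\Phi_a$ on $\mathbb N^{\mathbb N}$ that maps every name of every $b\in g(c)$ to a name of a point of $\operatorname{dom}(f)$. A solution is a pair $(q,y)$ where $q$ is a name of some $b\in g(c)$ and $y\in f(\delta_{\mathbf X}(\Phi_a(q)))$. **Proposition 9.** Let $k,\ell\in\mathbb N$. 1. If $f$ is $k$-guessable and $g$ is $\ell$-guessable, then $f\star g$ is $k\ell$-guessable. 2. If $f$ is $k$-guessable for some $k\in\mathbb N$ and $g$ is finitely guessable, then $f\star g$ is finitely guessable. 3. There are a finitely guessable $f$ and a $2$-guessable $g$ such that $f\star g$ is not finitely guessable. 4. If $f$ is finitely guessable and $g$ is eventually-finitely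 guessable, then $f\star g$ is eventually-finitely guessable. 5. There are an eventually-finitely guessable $f$ and a $2$-guessable $g$ such that $f\star g$ is not eventually-finitely guessable. -/

import Mathlib

open Filter

universe u v w z

namespace Weihrauch

/-! ### Computability on Baire space -/

/-- Baire space, as a set of sequences of natural numbers. -/
abbrev Baire : Type := ℕ → ℕ

/-- The finite prefix `p 0, …, p (t - 1)` of `p`. -/
def pre (p : Baire) (t : ℕ) : List ℕ := (List.range t).map p

/-- The words `s 0, s 1, …` are all prefixes of the infinite sequence `r`, and their lengths tend to
infinity: they are successive states of a one-way output tape on which `r` is being written. -/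
def Converges (s : ℕ → List ℕ) (r : Baire) : Prop :=
  (∀ t, s t = pre r (s t).length) ∧ Tendsto (fun t => (s t).length) atTop atTop

theorem Converges.unique {s : ℕ → List ℕ} {r r' : Baire} (h : Converges s r)
    (h' : Converges s r') : r = r' := by
  funext n
  obtain ⟨t, ht⟩ := (h.2.eventually_ge_atTop (n + 1)).exists
  have e : pre r (s t).length = pre r' (s t).length := (h.1 t).symm.trans (h'.1 t)
  have hn : n ∈ List.range (s t).length := List.mem_range.2 ht
  exact (List.map_inj_left.1 e) n hn

/-- The word function coded by `a`. Every function from words to words has such a code. -/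
def wordFun (a : Baire) (l : List ℕ) : List ℕ :=
  Denumerable.ofNat (List ℕ) (a (Encodable.encode l))

/-- `Eval a p r` says `Φ_a(p) = r`, where `Φ_a` is the partial continuous function on Baire space
coded by `a`: from longer and longer prefixes of `p`, the word function coded by `a` produces longer
and longer prefixes of `r`. `Φ_a(p)` is undefined if there is no such `r`. The partial functions
with a computable extension are those that are extended by `Φ_a` for a computable `a`. -/
def Eval (a p r : Baire) : Prop := Converges (fun t => wordFun a (pre p t)) r

theorem Eval.unique {a p r r' : Baire} (h : Eval a p r) (h' : Eval a p r') : r = r' :=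
  Converges.unique h h'

/-! ### Represented spaces -/

/-- A represented space: a set with a partial surjection `δ` from Baire space onto it, given through
its graph: `Names p x` says `δ(p) = x`. -/
structure RepresentedSpace : Type (u + 1) where
  carrier : Type u
  Names : Baire → carrier → Prop
  functional : ∀ {p x y}, Names p x → Names p y → x = y
  surjective : ∀ x, ∃ p, Names p x

/-- Baire space, represented by the identity. -/
def baireSpace : RepresentedSpace.{0} where
  carrier := Baire
  Names p x := p = x
  functional h h' := h.symm.trans h'
  surjective x := ⟨x, rfl⟩

/-- The product of two represented spaces: the even entries name the first component and the odd
entries name the second one. -/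
def RepresentedSpace.prod (X : RepresentedSpace.{u}) (Y : RepresentedSpace.{v}) :
    RepresentedSpace.{max u v} where
  carrier := X.carrier × Y.carrier
  Names p x := X.Names (fun n => p (2 * n)) x.1 ∧ Y.Names (fun n => p (2 * n + 1)) x.2
  functional h h' := Prod.ext (X.functional h.1 h'.1) (Y.functional h.2 h'.2)
  surjective x := by
    obtain ⟨p, hp⟩ := X.surjective x.1
    obtain ⟨q, hq⟩ := Y.surjective x.2
    refine ⟨fun n => if n % 2 = 0 then p (n / 2) else q (n / 2), ?_, ?_⟩
    · convert hp using 2 with n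
      simp
    · convert hq using 2 with n
      have h1 : (2 * n + 1) % 2 = 1 := by omega
      have h2 : (2 * n + 1) / 2 = n := by omega
      simp [h1, h2]

/-- Delete the zeros of a word and decrease all other entries by one. -/
def strip (l : List ℕ) : List ℕ := (l.filter (fun m => m ≠ 0)).map (fun m => m - 1)

/-- `StripsTo p q` says `p - 1 = q`: the sequence `q` arises from `p` by deleting all zeros and
decreasing all other entries by one. There is no such `q` if almost all entries of `p` are zero. -/
def StripsTo (p q : Baire) : Prop := Converges (fun t => strip (pre p t)) q

theorem pre_succ (p : Baire) (t : ℕ) : pre p (t + 1) = pre p t ++ [p t] := by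
  simp [pre, List.range_succ]

theorem pre_length (p : Baire) (t : ℕ) : (pre p t).length = t := by
  simp [pre]

theorem stripsTo_succ (q : Baire) : StripsTo (fun n => q n + 1) q := by
  have h : ∀ t, strip (pre (fun n => q n + 1) t) = pre q t := by
    intro t
    induction t with
    | zero => rfl
    | succ t ih => rw [pre_succ, pre_succ, ← ih]; simp [strip]
  refine ⟨fun t => ?_, ?_⟩
  · simp only [h, pre_length]
  · simp only [h, pre_length]; exact tendsto_id

theorem not_stripsTo_zero (q : Baire) : ¬ StripsTo (fun _ => 0) q := by
  intro h
  obtain ⟨t, ht⟩ := (h.2.eventually_ge_atTop 1).exists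
  have : strip (pre (fun _ => 0) t) = [] := by simp [strip, pre]
  simp [this] at ht

/-- The completion of a represented space: a bottom element `none` is added, and the representation
is total. A sequence `p` names `δ(p - 1)` if that is defined, and it names bottom otherwise. -/
def RepresentedSpace.completion (X : RepresentedSpace.{u}) : RepresentedSpace.{u} where
  carrier := Option X.carrier
  Names p
    | some x => ∃ q, StripsTo p q ∧ X.Names q x
    | none => ¬ ∃ q x, StripsTo p q ∧ X.Names q x
  functional {p x y} h h' := by
    match x, y, h, h' with
    | none, none, _, _ => rfl
    | none, some y, h, ⟨q, hq⟩ => exact absurd ⟨q, y, hq⟩ h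
    | some x, none, ⟨q, hq⟩, h' => exact absurd ⟨q, x, hq⟩ h'
    | some x, some y, ⟨q, hq, hx⟩, ⟨q', hq', hy⟩ =>
      obtain rfl := Converges.unique hq hq'
      rw [X.functional hx hy]
  surjective x := by
    match x with
    | none => exact ⟨fun _ => 0, fun ⟨q, _, h, _⟩ => not_stripsTo_zero q h⟩
    | some x =>
      obtain ⟨q, hq⟩ := X.surjective x
      exact ⟨fun n => q n + 1, q, stripsTo_succ q, hq⟩

/-- The `i`-th sequence in the countable tuple of sequences coded by `p`. -/
def comp (p : Baire) (i : ℕ) : Baire := fun n => p (Nat.pair i n)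

/-- The sequence that codes a countable tuple of sequences. -/
def tuple (s : ℕ → Baire) : Baire := fun n => s n.unpair.1 n.unpair.2

@[simp] theorem comp_tuple (s : ℕ → Baire) (i : ℕ) : comp (tuple s) i = s i := by
  funext n; simp [comp, tuple]

/-- The space `X ^ k` of `k`-tuples of points of `X`. -/
def RepresentedSpace.pow (X : RepresentedSpace.{u}) (k : ℕ) : RepresentedSpace.{u} where
  carrier := Fin k → X.carrier
  Names p x := ∀ i : Fin k, X.Names (comp p i) (x i)
  functional h h' := funext fun i => X.functional (h i) (h' i)
  surjective x := by
    choose q hq using fun i => X.surjective (x i)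
    refine ⟨tuple fun i => if h : i < k then q ⟨i, h⟩ else 0, fun i => ?_⟩
    simpa using hq i

/-- The space `X ^ *`, the disjoint union of all `X ^ n`: a name of a finite sequence starts with
its length, and names of the members follow. -/
def RepresentedSpace.star (X : RepresentedSpace.{u}) : RepresentedSpace.{u} where
  carrier := List X.carrier
  Names p l := p 0 = l.length ∧
    ∀ (i : ℕ) (h : i < l.length), X.Names (comp (fun n => p (n + 1)) i) l[i]
  functional h h' := List.ext_getElem (h.1.symm.trans h'.1) fun i hi hi' =>
    X.functional (h.2 i hi) (h'.2 i hi')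
  surjective l := by
    choose q hq using X.surjective
    refine ⟨fun n => n.casesOn l.length
      (tuple fun i => if h : i < l.length then q l[i] else 0), rfl, fun i hi => ?_⟩
    change X.Names (comp (tuple _) i) _
    simpa [hi] using hq l[i]

/-- The space `X ^ {<ω}` of finite sequences whose length is only approximated from below: the
zeroth component of a name is a sequence of natural numbers with maximum the length, and the
component with number `i + 1` names the `i`-th member of the sequence. -/
def RepresentedSpace.ltOmega (X : RepresentedSpace.{u}) : RepresentedSpace.{u} where
  carrier := List X.carrier
  Names p l := IsGreatest (Set.range (comp p 0)) l.length ∧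
    ∀ (i : ℕ) (h : i < l.length), X.Names (comp p (i + 1)) l[i]
  functional h h' := List.ext_getElem (h.1.unique h'.1) fun i hi hi' =>
    X.functional (h.2 i hi) (h'.2 i hi')
  surjective l := by
    choose q hq using X.surjective
    refine ⟨tuple fun i => i.casesOn (fun _ => l.length)
      (fun i => if h : i < l.length then q l[i] else 0), ?_, fun i hi => ?_⟩
    · simp
    · simpa [hi] using hq l[i]

/-! ### Problems and guessability -/

/-- A problem, i.e. a partial multivalued function between represented spaces. It is undefined where
the set of values is empty. -/
abbrev Problem (X : RepresentedSpace.{u}) (Y : RepresentedSpace.{v}) : Type (max u v) :=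
  X.carrier → Set Y.carrier

/-- The domain of a problem. -/
def Problem.dom {X : RepresentedSpace.{u}} {Y : RepresentedSpace.{v}} (f : Problem X Y) :
    Set X.carrier := {x | (f x).Nonempty}

/-- `h` is computable as a multivalued function with domain `D`: some computable partial function
maps every name of every `x ∈ D` to a name of a member of `h x`. -/
def ComputableOn {X : RepresentedSpace.{u}} {Y : RepresentedSpace.{v}} (D : Set X.carrier)
    (h : Problem X Y) : Prop :=
  ∃ a : Baire, Computable a ∧ ∀ x ∈ D, ∀ p, X.Names p x →
    ∃ r, Eval a p r ∧ ∃ y ∈ h x, Y.Names r y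

/-- The problem of making `k` guesses, one of which solves `f`. -/
def guessPow {X : RepresentedSpace.{u}} {Y : RepresentedSpace.{v}} (k : ℕ) (f : Problem X Y) :
    Problem X (Y.completion.pow k) :=
  fun x => {s : Fin k → Option Y.carrier | ∃ i, ∃ y ∈ f x, s i = some y}

/-- The problem of making finitely many guesses, one of which solves `f`, after saying how many. -/
def guessStar {X : RepresentedSpace.{u}} {Y : RepresentedSpace.{v}} (f : Problem X Y) :
    Problem X Y.completion.star :=
  fun x => {l : List (Option Y.carrier) | ∃ y ∈ f x, some y ∈ l}

/-- The problem of making finitely many guesses, one of which solves `f`, where a further guess may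
always be added. -/
def guessLtOmega {X : RepresentedSpace.{u}} {Y : RepresentedSpace.{v}} (f : Problem X Y) :
    Problem X Y.completion.ltOmega :=
  fun x => {l : List (Option Y.carrier) | ∃ y ∈ f x, some y ∈ l}

/-- `f` is `k`-guessable. -/
def KGuessable {X : RepresentedSpace.{u}} {Y : RepresentedSpace.{v}} (k : ℕ) (f : Problem X Y) :
    Prop := ComputableOn f.dom (guessPow k f)

/-- `f` is finitely guessable. -/
def FinitelyGuessable {X : RepresentedSpace.{u}} {Y : RepresentedSpace.{v}} (f : Problem X Y) :
    Prop := ComputableOn f.dom (guessStar f)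

/-- `f` is eventually-finitely guessable. -/
def EventuallyFinitelyGuessable {X : RepresentedSpace.{u}} {Y : RepresentedSpace.{v}}
    (f : Problem X Y) : Prop := ComputableOn f.dom (guessLtOmega f)

/-! ### The compositional product -/

/-- The compositional product `f ⋆ g` (first `g`, then `f`), through its standard representative.
An instance is a pair `(a, c)` where `c` is an instance of `g` and `a` codes a partial continuous
function `Φ_a` that maps every name `q` of every solution of `c` to a name of an instance of `f`.
A solution is a pair `(q, y)` where `q` names a solution of `c` and `y` solves the instance of `f`
named by `Φ_a(q)`. -/
def compProd {X : RepresentedSpace.{u}} {Y : RepresentedSpace.{v}} {Z : RepresentedSpace.{w}}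
    {W : RepresentedSpace.{z}} (f : Problem X Y) (g : Problem Z W) :
    Problem (baireSpace.prod Z) (baireSpace.prod Y) :=
  fun (ac : Baire × Z.carrier) => {s : Baire × Y.carrier |
    (∀ b ∈ g ac.2, ∀ q, W.Names q b → ∃ r, Eval ac.1 q r ∧ ∃ x ∈ f.dom, X.Names r x) ∧
    (∃ b ∈ g ac.2, W.Names s.1 b) ∧
    ∃ r, Eval ac.1 s.1 r ∧ ∃ x, X.Names r x ∧ s.2 ∈ f x}

end Weihrauch

open Weihrauch

namespace Weihrauch

/-! ### Words approximating sequences -/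

/-! Upper bounds. Run the guesser for `g`, strip its `j`-th guess, feed it to `Φ_a`, run the guesser
for `f` on the result, and pair the `j`-th inner guess with the `i`-th outer one. If `j` is a
correct guess, then `Φ_a` is defined there and some `i` is correct as well (`GuessesBy.compProd`).
For a wrong `j` the computation may stall or produce garbage. This does no harm: `emit` fills
waiting times with zeros, so each guess is a total sequence, and each sequence names something in
the completion. What remains is to count. With `k` outer guesses the pairs are numbered `i + k * j`,
which gives `k * l` guesses, or `k` times the inner number once that has been read. If the outer
number is computed and the inner one is only approximated, the outer number for `j` may never
appear. It is announced only if it appears, and at most one value is accepted for each `j`. Only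
finitely many `j` count, so the announcements have a maximum (`announce_bddAbove`,
`exists_announce`).

Lower bounds. Take for `g` the extraction of a point from the completion, which needs two guesses:
the input itself, and a default. Every sequence names a point of the completion, so a guesser for
the composition acts continuously on all of Baire space (`GuessesBy.exists_continuous`). Take for
`f` the limit of an eventually constant sequence, with a bound on the limit in the finitely
guessable case. By `exists_limit_not_guessed`, `L` continuous guesses cannot cover the limits `0, …,
L` on a nonempty open set. With a bound: write zeros, which commit to nothing, until the guesser has
fixed its number `L`, and only then write the bound `L`. Without a bound: the Baire category theorem
yields an open set on which the number of guesses is at most a fixed `L`. -/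

theorem getElem?_pre (p : Baire) (t n : ℕ) : (pre p t)[n]? = if n < t then some (p n) else none := by
  by_cases h : n < t <;> simp [pre, h]

theorem take_pre {p : Baire} {s t : ℕ} (h : s ≤ t) : (pre p t).take s = pre p s := by
  simp [pre, ← List.map_take, List.take_range, h]

theorem converges_pre (p : Baire) : Converges (pre p) p :=
  ⟨fun t => by rw [pre_length], by simp only [pre_length]; exact tendsto_id⟩

theorem Converges.eq_of_getElem? {s : ℕ → List ℕ} {r : Baire} (h : Converges s r) {t n v : ℕ}
    (hv : (s t)[n]? = some v) : v = r n := by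
  rw [h.1 t, getElem?_pre] at hv
  split_ifs at hv
  exact (Option.some.inj hv).symm

theorem Converges.eventually_getElem? {s : ℕ → List ℕ} {r : Baire} (h : Converges s r) (n : ℕ) :
    ∀ᶠ t in atTop, (s t)[n]? = some (r n) := by
  filter_upwards [h.2.eventually_gt_atTop n] with t ht
  rw [h.1 t, getElem?_pre, if_pos ht]

theorem Converges.eventually_take {s : ℕ → List ℕ} {r : Baire} (h : Converges s r) (n : ℕ) :
    ∀ᶠ t in atTop, (s t).take n = pre r n := by
  filter_upwards [h.2.eventually_ge_atTop n] with t ht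
  rw [h.1 t, take_pre ht]

/-- Each `s t` is the prefix of `p` of length `(s t).length`, so this is a mere change of the time
scale. It allows computations on growing words to be chained. -/
theorem Converges.map {s : ℕ → List ℕ} {p r : Baire} {F : List ℕ → List ℕ} (h : Converges s p)
    (hF : Converges (fun t => F (pre p t)) r) : Converges (fun t => F (s t)) r := by
  have e : (fun t => F (s t)) = (fun t => F (pre p t)) ∘ fun t => (s t).length := by
    funext t; simp [← h.1 t]
  rw [e]
  exact ⟨fun t => hF.1 _, hF.2.comp h.2⟩

/-- The word `G 0, G 1, …` of length at most `N` that ends before the first undefined value. -/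
def collect (G : ℕ → Option ℕ) (N : ℕ) : List ℕ :=
  Nat.rec [] (fun _ l => l ++ (G l.length).toList) N

theorem collect_succ (G : ℕ → Option ℕ) (N : ℕ) :
    collect G (N + 1) = collect G N ++ (G (collect G N).length).toList := rfl

theorem collect_eq_pre {G : ℕ → Option ℕ} {r : Baire} (h : ∀ n v, G n = some v → v = r n)
    (N : ℕ) : collect G N = pre r (collect G N).length := by
  induction N with
  | zero => rfl
  | succ N ih =>
    rw [collect_succ]
    cases hG : G (collect G N).length with
    | none => simpa using ih
    | some v =>
      have := h _ _ hG
      simp only [Option.toList_some, List.length_append, List.length_cons, List.length_nil,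
        zero_add]
      rw [pre_succ, ← ih, this]

theorem le_length_collect {G : ℕ → Option ℕ} {m : ℕ} (h : ∀ n < m, (G n).isSome) {N : ℕ}
    (hN : m ≤ N) : m ≤ (collect G N).length := by
  have key : ∀ N, min m N ≤ (collect G N).length := by
    intro N
    induction N with
    | zero => simp
    | succ N ih =>
      rw [collect_succ, List.length_append]
      by_cases hm : (collect G N).length < m
      · obtain ⟨v, hv⟩ := Option.isSome_iff_exists.1 (h _ hm)
        rw [hv]
        simp only [Option.toList_some, List.length_cons, List.length_nil]
        omega
      · omega
  have := key N
  omega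

/-- The criterion behind all convergence proofs below: entries may be found in any order and at any
time, as long as no wrong value is ever given and each entry is eventually given. Stopping at the
first gap turns this into growing prefixes. -/
theorem converges_collect {G : ℕ → ℕ → Option ℕ} {N : ℕ → ℕ} {r : Baire}
    (h : ∀ t n v, G t n = some v → v = r n) (h' : ∀ n, ∀ᶠ t in atTop, (G t n).isSome)
    (hN : Tendsto N atTop atTop) : Converges (fun t => collect (G t) (N t)) r := by
  refine ⟨fun t => collect_eq_pre (h t) _, tendsto_atTop.2 fun m => ?_⟩
  have : ∀ᶠ t in atTop, ∀ n < m, (G t n).isSome := by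
    have := (Filter.eventually_all_finite (Set.finite_Iio m)).2 fun n _ => h' n
    exact this
  filter_upwards [this, hN.eventually_ge_atTop m] with t ht hm
  exact le_length_collect ht hm

theorem Computable.collect {α : Type*} [Primcodable α] {G : α → ℕ → Option ℕ} {N : α → ℕ}
    (hG : Computable₂ G) (hN : Computable N) : Computable fun a => collect (G a) (N a) := by
  refine Computable.nat_rec (g := fun _ => ([] : List ℕ))
    (h := fun a x => x.2 ++ (G a x.2.length).toList) hN (Computable.const _) ?_
  have hl : Computable fun x : α × ℕ × List ℕ => x.2.2 := Computable.snd.comp Computable.snd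
  exact (Computable.list_append.comp hl (Primrec.optionToList.to_comp.comp
    (hG.comp Computable.fst (Computable.list_length.comp hl)))).to₂

/-- The first defined value among `h 0, …, h (N - 1)`. -/
def firstSome {β : Type*} (h : ℕ → Option β) (N : ℕ) : Option β :=
  Nat.rec none (fun s o => o <|> h s) N

theorem firstSome_succ {β : Type*} (h : ℕ → Option β) (N : ℕ) :
    firstSome h (N + 1) = (firstSome h N <|> h N) := rfl

theorem exists_of_firstSome {β : Type*} {h : ℕ → Option β} {N : ℕ} {v : β}
    (hv : firstSome h N = some v) : ∃ s < N, h s = some v := by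
  induction N with
  | zero => simp [firstSome] at hv
  | succ N ih =>
    rw [firstSome_succ] at hv
    cases ho : firstSome h N with
    | none =>
      rw [ho] at hv
      exact ⟨N, N.lt_succ_self, by simpa using hv⟩
    | some w =>
      rw [ho] at hv
      obtain ⟨s, hs, hs'⟩ := ih (by rw [ho]; simpa using hv)
      exact ⟨s, by omega, hs'⟩

theorem firstSome_mono {β : Type*} {h : ℕ → Option β} {N M : ℕ} {v : β} (hNM : N ≤ M)
    (hv : firstSome h N = some v) : firstSome h M = some v := by
  induction hNM with
  | refl => exact hv
  | step _ ih => rw [firstSome_succ, ih]; rfl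

theorem isSome_firstSome {β : Type*} {h : ℕ → Option β} {N s : ℕ} (hs : s < N)
    (hv : (h s).isSome) : (firstSome h N).isSome := by
  have : (firstSome h (s + 1)).isSome := by
    rw [firstSome_succ]
    cases firstSome h s <;> simp [hv]
  obtain ⟨v, hv⟩ := Option.isSome_iff_exists.1 this
  rw [firstSome_mono hs hv]; rfl

theorem firstSome_congr {β : Type*} {h h' : ℕ → Option β} {N : ℕ} (e : ∀ s < N, h s = h' s) :
    firstSome h N = firstSome h' N := by
  induction N with
  | zero => rfl
  | succ N ih =>
    rw [firstSome_succ, firstSome_succ, ih fun s hs => e s (by omega), e N N.lt_succ_self]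

theorem Computable.firstSome {α β : Type*} [Primcodable α] [Primcodable β]
    {h : α → ℕ → Option β} {N : α → ℕ} (hh : Computable₂ h) (hN : Computable N) :
    Computable fun a => firstSome (h a) (N a) := by
  refine Computable.nat_rec (g := fun _ => (none : Option β))
    (h := fun a x => (x.2 <|> h a x.1)) hN (Computable.const _) ?_
  exact (Primrec.option_orElse.to_comp.comp (Computable.snd.comp Computable.snd)
    (hh.comp Computable.fst (Computable.fst.comp Computable.snd))).to₂

/-! ### Operations on words -/

/-- The longest initial part of `n ↦ p (φ n)` that is determined by the prefix `l` of `p`. -/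
def reindexWord (φ : ℕ → ℕ) (l : List ℕ) : List ℕ := collect (fun n => l[φ n]?) l.length

theorem Converges.reindexWord {s : ℕ → List ℕ} {p : Baire} (h : Converges s p) (φ : ℕ → ℕ) :
    Converges (fun t => reindexWord φ (s t)) fun n => p (φ n) :=
  converges_collect (fun _ _ _ hv => h.eq_of_getElem? hv)
    (fun n => (h.eventually_getElem? (φ n)).mono fun t ht => by rw [ht]; rfl) h.2

theorem Computable.reindexWord {α : Type*} [Primcodable α] {φ : α → ℕ → ℕ} {l : α → List ℕ}
    (hφ : Computable₂ φ) (hl : Computable l) : Computable fun a => reindexWord (φ a) (l a) :=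
  Computable.collect (Computable.list_getElem?.comp (hl.comp Computable.fst) hφ)
    (Computable.list_length.comp hl)

/-- The entries of `l` in the even positions and those of `l'` in the odd ones. -/
def pairWord (l l' : List ℕ) : List ℕ :=
  collect (fun n => bif n.bodd then l'[n.div2]? else l[n.div2]?) (l.length + l'.length)

/-- The sequence whose even entries form `p` and whose odd entries form `q`. -/
def pairSeq (p q : Baire) : Baire := fun n => bif n.bodd then q n.div2 else p n.div2

@[simp] theorem pairSeq_even (p q : Baire) (n : ℕ) : pairSeq p q (2 * n) = p n := by
  simp [pairSeq, Nat.div2_val]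

@[simp] theorem pairSeq_odd (p q : Baire) (n : ℕ) : pairSeq p q (2 * n + 1) = q n := by
  simp [pairSeq, Nat.div2_val]

theorem Converges.pairWord {s s' : ℕ → List ℕ} {p q : Baire} (h : Converges s p)
    (h' : Converges s' q) : Converges (fun t => pairWord (s t) (s' t)) (pairSeq p q) := by
  refine converges_collect (fun t n v hv => ?_) (fun n => ?_)
    (tendsto_atTop_mono (fun _ => Nat.le_add_right _ _) h.2)
  · unfold pairSeq
    cases hn : n.bodd with
    | false => rw [hn] at hv; exact h.eq_of_getElem? hv
    | true => rw [hn] at hv; exact h'.eq_of_getElem? hv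
  · filter_upwards [h.eventually_getElem? n.div2, h'.eventually_getElem? n.div2] with t ht ht'
    rw [ht, ht']
    cases n.bodd <;> rfl

theorem Computable.pairWord {α : Type*} [Primcodable α] {l l' : α → List ℕ} (hl : Computable l)
    (hl' : Computable l') : Computable fun a => pairWord (l a) (l' a) := by
  have hd : Computable fun x : α × ℕ => x.2.div2 := Computable.nat_div2.comp Computable.snd
  refine Computable.collect (Computable.cond (Computable.nat_bodd.comp Computable.snd)
    (Computable.list_getElem?.comp (hl'.comp Computable.fst) hd)
    (Computable.list_getElem?.comp (hl.comp Computable.fst) hd)) ?_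
  exact Primrec.nat_add.to_comp.comp (Computable.list_length.comp hl)
    (Computable.list_length.comp hl')

theorem Converges.strip {s : ℕ → List ℕ} {p q : Baire} (h : Converges s p) (h' : StripsTo p q) :
    Converges (fun t => strip (s t)) q := h.map h'

theorem computable_strip : Computable strip := by
  have h : Primrec fun l : List ℕ => (l.filter (fun m => m ≠ 0)).map (fun m => m - 1) := by
    refine Primrec.list_map ?_ (Primrec.nat_sub.comp Primrec.snd (Primrec.const 1))
    exact Primrec.listFilter (p := fun m : ℕ => m ≠ 0)
      (PrimrecPred.not (Primrec.eq.comp Primrec.id (Primrec.const 0)))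
  exact h.to_comp

theorem computable_wordFun {a : Baire} (ha : Computable a) : Computable (wordFun a) :=
  (Computable.ofNat (List ℕ)).comp (ha.comp Computable.encode)

/-- The part of `Φ_a(q)` that is determined by the prefixes `α` of `a` and `l` of `q`. -/
def applyWord (α l : List ℕ) : List ℕ :=
  collect (fun n => firstSome (fun s => (α[Encodable.encode (l.take s)]?).bind
    fun m => (Denumerable.ofNat (List ℕ) m)[n]?) (l.length + 1)) l.length

theorem Converges.applyWord {s s' : ℕ → List ℕ} {a q r : Baire} (h : Converges s a)
    (h' : Converges s' q) (hr : Eval a q r) :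
    Converges (fun t => applyWord (s t) (s' t)) r := by
  refine converges_collect (fun t n v hv => ?_) (fun n => ?_) h'.2
  · obtain ⟨i, hi, hv⟩ := exists_of_firstSome hv
    obtain ⟨m, hm, hv⟩ := Option.bind_eq_some_iff.1 hv
    rw [h'.1 t, take_pre (by omega)] at hm
    rw [h.eq_of_getElem? hm] at hv
    exact Converges.eq_of_getElem? hr (t := i) hv
  -- Some prefix of `q` of length `i` already determines entry `n`. The code `a` must be known at
  -- the code of that prefix; this need not hold for the longest known prefix of `q`, hence the
  -- search over all shorter ones.
  · obtain ⟨i, hi⟩ := (Converges.eventually_getElem? hr n).exists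
    filter_upwards [h.eventually_getElem? (Encodable.encode (pre q i)),
      h'.eventually_take i, h'.2.eventually_ge_atTop i] with t ht ht' hl
    refine isSome_firstSome (s := i) (by omega) ?_
    rw [ht', ht]
    change ((wordFun a (pre q i))[n]?).isSome
    rw [hi]; rfl

theorem Computable.applyWord {α : Type*} [Primcodable α] {l l' : α → List ℕ} (hl : Computable l)
    (hl' : Computable l') : Computable fun a => applyWord (l a) (l' a) := by
  refine Computable.collect ?_ (Computable.list_length.comp hl')
  refine Computable.firstSome (α := α × ℕ) ?_
    (Computable.succ.comp (Computable.list_length.comp (hl'.comp Computable.fst)))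
  refine Computable.option_bind (α := (α × ℕ) × ℕ) ?_ ?_
  · exact Computable.list_getElem?.comp (hl.comp (Computable.fst.comp Computable.fst))
      (Computable.encode.comp (Primrec.list_take.to_comp.comp Computable.snd
        (hl'.comp (Computable.fst.comp Computable.fst))))
  · exact Computable.list_getElem?.comp ((Computable.ofNat (List ℕ)).comp Computable.snd)
      (Computable.snd.comp (Computable.fst.comp Computable.fst))

/-! ### Totalizing a partial output -/

/-- The number of entries of the growing word `S` that have been written before stage `t`, if at
most one is written per stage. -/
def emitCount (S : ℕ → List ℕ) (t : ℕ) : ℕ :=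
  Nat.rec 0 (fun s m => Option.casesOn (S s)[m]? m fun _ => m + 1) t

/-- The sequence obtained by writing the entries of the growing word `S`, increased by one, with
zeros at the stages at which the next entry is not yet known. -/
def emit (S : ℕ → List ℕ) : Baire := fun t => ((S t)[emitCount S t]?.map Nat.succ).getD 0

theorem emitCount_succ (S : ℕ → List ℕ) (t : ℕ) :
    emitCount S (t + 1) = if emitCount S t < (S t).length then emitCount S t + 1
      else emitCount S t := by
  change (Option.casesOn (S t)[emitCount S t]? (emitCount S t) (fun _ => emitCount S t + 1) : ℕ) = _
  split_ifs with h
  · rw [List.getElem?_eq_getElem h]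
  · rw [List.getElem?_eq_none (not_lt.1 h)]

theorem emitCount_congr {S S' : ℕ → List ℕ} {t : ℕ} (h : ∀ s < t, S s = S' s) :
    emitCount S t = emitCount S' t := by
  induction t with
  | zero => rfl
  | succ t ih =>
    have e := ih fun s hs => h s (by omega)
    rw [emitCount_succ, emitCount_succ, e, h t t.lt_succ_self]

/-- Causality: entry `t` uses only the stages up to `t`, so it can be computed from a finite prefix
of the input. -/
theorem emit_congr {S S' : ℕ → List ℕ} {t : ℕ} (h : ∀ s ≤ t, S s = S' s) :
    emit S t = emit S' t := by
  rw [emit, emit, emitCount_congr fun s hs => h s hs.le, h t le_rfl]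

theorem emitCount_mono (S : ℕ → List ℕ) : Monotone (emitCount S) :=
  monotone_nat_of_le_succ fun t => by rw [emitCount_succ]; split_ifs <;> omega

/-- The nonzero entries written before stage `t` are exactly the first `emitCount S t` entries of
`r`, each increased by one. This count is unbounded, because the word eventually outgrows any value
at which it could get stuck. -/
theorem Converges.stripsTo_emit {S : ℕ → List ℕ} {r : Baire} (h : Converges S r) :
    StripsTo (emit S) r := by
  have e : ∀ t, Weihrauch.strip (pre (emit S) t) = pre r (emitCount S t) := by
    intro t
    induction t with
    | zero => rfl
    | succ t ih =>
      have hs : Weihrauch.strip (pre (emit S) (t + 1)) = Weihrauch.strip (pre (emit S) t) ++ Weihrauch.strip [emit S t] := by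
        rw [pre_succ]; simp [Weihrauch.strip, List.filter_append]
      rw [hs, ih, emitCount_succ]
      split_ifs with hc
      · have : (S t)[emitCount S t]? = some (r (emitCount S t)) := by
          rw [h.1 t, getElem?_pre, if_pos hc]
        simp [emit, this, Weihrauch.strip, pre_succ]
      · simp [emit, List.getElem?_eq_none (not_lt.1 hc), Weihrauch.strip]
  have lim : Tendsto (emitCount S) atTop atTop := by
    refine tendsto_atTop_atTop_of_monotone (emitCount_mono S) fun m => ?_
    induction m with
    | zero => exact ⟨0, Nat.zero_le _⟩
    | succ m ih =>
      obtain ⟨t₀, ht₀⟩ := ih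
      obtain ⟨t, ht, htt⟩ := ((h.2.eventually_gt_atTop m).and (eventually_ge_atTop t₀)).exists
      refine ⟨t + 1, ?_⟩
      have := emitCount_mono S htt
      rw [emitCount_succ]
      split_ifs <;> omega
  exact ⟨fun t => by simp only [e, pre_length], by simpa only [e, pre_length] using lim⟩

theorem Computable.emit {α : Type*} [Primcodable α] {S : α → ℕ → List ℕ} {t : α → ℕ}
    (hS : Computable₂ S) (ht : Computable t) : Computable fun a => emit (S a) (t a) := by
  have hc : Computable fun a => emitCount (S a) (t a) := by
    refine Computable.nat_rec (g := fun _ => (0 : ℕ))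
      (h := fun a x => Option.casesOn (S a x.1)[x.2]? x.2 fun _ => x.2 + 1) ht
      (Computable.const _) ?_
    have hm : Computable fun x : α × ℕ × ℕ => x.2.2 := Computable.snd.comp Computable.snd
    exact (Computable.option_casesOn (Computable.list_getElem?.comp
      (hS.comp Computable.fst (Computable.fst.comp Computable.snd)) hm) hm
      (Computable.succ.comp (hm.comp Computable.fst)).to₂).to₂
  refine Computable.option_getD (Computable.option_map
    (Computable.list_getElem?.comp (hS.comp Computable.id ht) hc) ?_) (Computable.const 0)
  exact (Computable.succ.comp Computable.snd).to₂

/-! ### Codes of computable functions -/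

theorem exists_wordFun_eq {F : List ℕ → List ℕ} (hF : Computable F) :
    ∃ a : Baire, Computable a ∧ wordFun a = F := by
  refine ⟨fun n => Encodable.encode (F (Denumerable.ofNat (List ℕ) n)),
    Computable.encode.comp (hF.comp (Computable.ofNat _)), ?_⟩
  funext l
  simp [wordFun]

/-- All guessers below are built with this: it suffices to compute single output entries from input
prefixes, with `none` meaning that more input is needed. -/
theorem exists_computable_eval {G : List ℕ → ℕ → Option ℕ} (hG : Computable₂ G) :
    ∃ a : Baire, Computable a ∧ ∀ p r : Baire, (∀ t n v, G (pre p t) n = some v → v = r n) →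
      (∀ n, ∀ᶠ t in atTop, (G (pre p t) n).isSome) → Eval a p r := by
  obtain ⟨a, ha, e⟩ := exists_wordFun_eq (Computable.collect hG Computable.list_length)
  refine ⟨a, ha, fun p r h h' => ?_⟩
  simp only [Eval, e]
  exact converges_collect h h' (by simp only [pre_length]; exact tendsto_id)

theorem completion_names_total (X : RepresentedSpace.{u}) (p : Baire) :
    ∃ y, X.completion.Names p y := by
  by_cases h : ∃ q x, StripsTo p q ∧ X.Names q x
  · obtain ⟨q, x, h⟩ := h
    exact ⟨some x, q, h⟩
  · exact ⟨none, h⟩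

/-! ### Guessing, in terms of names -/

/-- The computable function coded by `A` makes guesses for `f`: on every name of an instance it
outputs some `r` such that, for some `m` with `L r m`, one of the first `m` sequences
`n ↦ r (ψ i n)` names a solution in the completion. -/
def GuessesBy {X : RepresentedSpace.{u}} {Y : RepresentedSpace.{v}} (L : Baire → ℕ → Prop)
    (ψ : ℕ → ℕ → ℕ) (A : Baire) (f : Problem X Y) : Prop :=
  ∀ x ∈ f.dom, ∀ p, X.Names p x → ∃ r, Eval A p r ∧ ∃ m, L r m ∧ ∃ i < m, ∃ q y,
    StripsTo (fun n => r (ψ i n)) q ∧ Y.Names q y ∧ y ∈ f x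

/-- Totality of the completed representation supplies points for the other guesses, so only the one
correct guess has to be examined. -/
theorem kGuessable_iff {X : RepresentedSpace.{u}} {Y : RepresentedSpace.{v}} {f : Problem X Y}
    {k : ℕ} : KGuessable k f ↔
      ∃ A, Computable A ∧ GuessesBy (fun _ m => k = m) Nat.pair A f := by
  refine exists_congr fun A => and_congr_right fun _ => forall₄_congr fun x _ p _ =>
    exists_congr fun r => and_congr_right fun _ => ⟨?_, ?_⟩
  · rintro ⟨s, ⟨i, y, hy, hs⟩, hn⟩
    have := hn i
    rw [hs] at this
    obtain ⟨q, hq, hqy⟩ := this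
    exact ⟨k, rfl, i, i.2, q, y, hq, hqy, hy⟩
  · rintro ⟨_, rfl, i, hi, q, y, hq, hqy, hy⟩
    choose s hs using fun j => completion_names_total Y (comp r j)
    have : s i = some y := Y.completion.functional (hs i) ⟨q, hq, hqy⟩
    exact ⟨fun j => s j, ⟨⟨i, hi⟩, y, hy, this⟩, fun j => hs j⟩

theorem exists_list_of_total {X : RepresentedSpace.{u}} {P : ℕ → Option X.carrier → Prop}
    (h : ∀ i, ∃ y, P i y) (m : ℕ) : ∃ l : List (Option X.carrier), l.length = m ∧
      ∀ (i : ℕ) (hi : i < l.length), P i l[i] := by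
  choose s hs using h
  exact ⟨(List.range m).map s, by simp, fun i hi => by simpa using hs i⟩

theorem finitelyGuessable_iff {X : RepresentedSpace.{u}} {Y : RepresentedSpace.{v}}
    {f : Problem X Y} : FinitelyGuessable f ↔ ∃ A, Computable A ∧
      GuessesBy (fun r m => r 0 = m) (fun i n => Nat.pair i n + 1) A f := by
  refine exists_congr fun A => and_congr_right fun _ => forall₄_congr fun x _ p _ =>
    exists_congr fun r => and_congr_right fun _ => ⟨?_, ?_⟩
  · rintro ⟨l, ⟨y, hy, hl⟩, h0, hn⟩
    obtain ⟨i, hi, e⟩ := List.getElem_of_mem hl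
    obtain ⟨q, hq, hqy⟩ := (congrArg (Y.completion.Names (comp (fun n => r (n + 1)) i)) e).mp (hn i hi)
    exact ⟨_, h0, i, hi, q, y, hq, hqy, hy⟩
  · rintro ⟨m, h0, i, hi, q, y, hq, hqy, hy⟩
    obtain ⟨l, rfl, hl⟩ := exists_list_of_total
      (fun j => completion_names_total Y (comp (fun n => r (n + 1)) j)) m
    have : l[i] = some y := Y.completion.functional (hl i hi) ⟨q, hq, hqy⟩
    exact ⟨l, ⟨y, hy, this ▸ List.getElem_mem hi⟩, h0, hl⟩

theorem eventuallyFinitelyGuessable_iff {X : RepresentedSpace.{u}} {Y : RepresentedSpace.{v}}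
    {f : Problem X Y} : EventuallyFinitelyGuessable f ↔ ∃ A, Computable A ∧
      GuessesBy (fun r m => IsGreatest (Set.range (comp r 0)) m)
        (fun i n => Nat.pair (i + 1) n) A f := by
  refine exists_congr fun A => and_congr_right fun _ => forall₄_congr fun x _ p _ =>
    exists_congr fun r => and_congr_right fun _ => ⟨?_, ?_⟩
  · rintro ⟨l, ⟨y, hy, hl⟩, h0, hn⟩
    obtain ⟨i, hi, e⟩ := List.getElem_of_mem hl
    obtain ⟨q, hq, hqy⟩ := (congrArg (Y.completion.Names (comp r (i + 1))) e).mp (hn i hi)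
    exact ⟨_, h0, i, hi, q, y, hq, hqy, hy⟩
  · rintro ⟨m, h0, i, hi, q, y, hq, hqy, hy⟩
    obtain ⟨l, rfl, hl⟩ := exists_list_of_total
      (fun j => completion_names_total Y (comp r (j + 1))) m
    have : l[i] = some y := Y.completion.functional (hl i hi) ⟨q, hq, hqy⟩
    exact ⟨l, ⟨y, hy, this ▸ List.getElem_mem hi⟩, h0, hl⟩

/-! ### Guesses for the compositional product -/

/-- The known part of the output of the guesses for the inner problem. -/
def innerOutput (B : Baire) (w : List ℕ) : List ℕ :=
  wordFun B (reindexWord (fun n => 2 * n + 1) w)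

/-- The known part of the `j`-th guess for the inner problem. -/
def innerGuess (B : Baire) (φ : ℕ → ℕ → ℕ) (j : ℕ) (w : List ℕ) : List ℕ :=
  strip (reindexWord (φ j) (innerOutput B w))

/-- The known part of the output of the guesses for the outer problem, provided that the `j`-th
guess for the inner problem is correct. -/
def outerOutput (A B : Baire) (φ : ℕ → ℕ → ℕ) (j : ℕ) (w : List ℕ) : List ℕ :=
  wordFun A (applyWord (reindexWord (fun n => 2 * n) w) (innerGuess B φ j w))

/-- The known part of the solution of the compositional product that consists of the `j`-th guess
for the inner problem and the resulting `i`-th guess for the outer one. -/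
def prodGuess (A B : Baire) (φ ψ : ℕ → ℕ → ℕ) (j i : ℕ) (w : List ℕ) : List ℕ :=
  pairWord (innerGuess B φ j w) (strip (reindexWord (ψ i) (outerOutput A B φ j w)))

section Computability

variable {α : Type*} [Primcodable α] {A B : Baire} {φ ψ : ℕ → ℕ → ℕ} {j i : α → ℕ}
  {l : α → List ℕ}

theorem computable_innerOutput (hB : Computable B) (hl : Computable l) :
    Computable fun a => innerOutput B (l a) :=
  (computable_wordFun hB).comp (Computable.reindexWord
    (φ := fun _ n => 2 * n + 1)
    (Computable.succ.comp (Primrec.nat_mul.to_comp.comp (Computable.const 2) Computable.snd)) hl)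

theorem computable_innerGuess (hB : Computable B) (hφ : Computable₂ φ) (hj : Computable j)
    (hl : Computable l) : Computable fun a => innerGuess B φ (j a) (l a) :=
  computable_strip.comp (Computable.reindexWord
    (hφ.comp (hj.comp Computable.fst) Computable.snd) (computable_innerOutput hB hl))

theorem computable_outerOutput (hA : Computable A) (hB : Computable B) (hφ : Computable₂ φ)
    (hj : Computable j) (hl : Computable l) :
    Computable fun a => outerOutput A B φ (j a) (l a) :=
  (computable_wordFun hA).comp (Computable.applyWord (Computable.reindexWord
    (φ := fun _ n => 2 * n)
    (Primrec.nat_mul.to_comp.comp (Computable.const 2) Computable.snd) hl)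
    (computable_innerGuess hB hφ hj hl))

theorem computable_prodGuess (hA : Computable A) (hB : Computable B) (hφ : Computable₂ φ)
    (hψ : Computable₂ ψ) (hj : Computable j) (hi : Computable i) (hl : Computable l) :
    Computable fun a => prodGuess A B φ ψ (j a) (i a) (l a) :=
  Computable.pairWord (computable_innerGuess hB hφ hj hl)
    (computable_strip.comp (Computable.reindexWord
      (hψ.comp (hi.comp Computable.fst) Computable.snd) (computable_outerOutput hA hB hφ hj hl)))

end Computability

/-- The total sequence made from the growing words `prodGuess`. -/
def prodGuessSeq (A B : Baire) (φ ψ : ℕ → ℕ → ℕ) (p : Baire) (j i : ℕ) : Baire :=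
  emit fun s => prodGuess A B φ ψ j i (pre p s)

/-- The `t`-th entry of `prodGuessSeq`, computed from a prefix of length at least `t`. -/
def prodGuessEntry (A B : Baire) (φ ψ : ℕ → ℕ → ℕ) (w : List ℕ) (j i t : ℕ) : Option ℕ :=
  if t ≤ w.length then some (emit (fun s => prodGuess A B φ ψ j i (w.take s)) t) else none

theorem prodGuessEntry_pre (A B : Baire) (φ ψ : ℕ → ℕ → ℕ) (p : Baire) (j i t T : ℕ) :
    prodGuessEntry A B φ ψ (pre p T) j i t =
      if t ≤ T then some (prodGuessSeq A B φ ψ p j i t) else none := by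
  rw [prodGuessEntry, pre_length]
  split_ifs with h
  · rw [prodGuessSeq, emit_congr fun s hs => ?_]
    rw [take_pre (hs.trans h)]
  · rfl

theorem computable_prodGuessEntry {α : Type*} [Primcodable α] {A B : Baire} {φ ψ : ℕ → ℕ → ℕ}
    {j i t : α → ℕ} {l : α → List ℕ} (hA : Computable A) (hB : Computable B)
    (hφ : Computable₂ φ) (hψ : Computable₂ ψ) (hj : Computable j) (hi : Computable i)
    (ht : Computable t) (hl : Computable l) :
    Computable fun a => prodGuessEntry A B φ ψ (l a) (j a) (i a) (t a) := by
  have h : Computable fun a => bif decide (t a ≤ (l a).length) then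
      some (emit (fun s => prodGuess A B φ ψ (j a) (i a) ((l a).take s)) (t a)) else none := by
    refine Computable.cond ?_ (Computable.option_some.comp (Computable.emit ?_ ht))
      (Computable.const _)
    · exact (Primrec.nat_le.decide).to_comp.comp ht (Computable.list_length.comp hl)
    · exact computable_prodGuess hA hB hφ hψ (hj.comp Computable.fst) (hi.comp Computable.fst)
        (Primrec.list_take.to_comp.comp Computable.snd (hl.comp Computable.fst))
  refine h.of_eq fun a => ?_
  by_cases ht : t a ≤ (l a).length <;> simp [prodGuessEntry, ht]

/-- Following a correct inner guess `j`, each stage of the computation converges: the stripped guess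
names a solution of `g`, so `Φ_a` maps it to a name of an instance of `f`, on which `A` makes a
correct guess `i`. Nothing is claimed about other `j`. -/
theorem GuessesBy.compProd {X : RepresentedSpace.{u}} {Y : RepresentedSpace.{v}}
    {Z : RepresentedSpace.{w}} {W : RepresentedSpace.{z}} {f : Problem X Y} {g : Problem Z W}
    {L L' : Baire → ℕ → Prop} {φ ψ : ℕ → ℕ → ℕ} {A B : Baire} (hf : GuessesBy L ψ A f)
    (hg : GuessesBy L' φ B g) {x : (baireSpace.prod Z).carrier} (hx : x ∈ (compProd f g).dom)
    {p : Baire} (hp : (baireSpace.prod Z).Names p x) :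
    ∃ b, Converges (fun t => innerOutput B (pre p t)) b ∧ ∃ m, L' b m ∧ ∃ j < m,
      ∃ e, Converges (fun t => outerOutput A B φ j (pre p t)) e ∧ ∃ m', L e m' ∧ ∃ i < m',
        ∃ q s, StripsTo (prodGuessSeq A B φ ψ p j i) q ∧ (baireSpace.prod Y).Names q s ∧
          s ∈ compProd f g x := by
  obtain ⟨a, c⟩ := x
  obtain ⟨rfl, hc⟩ := hp
  obtain ⟨_, hdom, ⟨c', hc', -⟩, -⟩ := hx
  obtain ⟨b, hb, m, hm, j, hj, q, y, hq, hqy, hy⟩ := hg c ⟨c', hc'⟩ _ hc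
  obtain ⟨r, hr, x, hx, hrx⟩ := hdom y hy q hqy
  obtain ⟨e, he, m', hm', i, hi, q', y', hq', hqy', hy'⟩ := hf x hx r hrx
  have hinner : Converges (fun t => innerOutput B (pre p t)) b :=
    ((converges_pre p).reindexWord _).map hb
  have hguess : Converges (fun t => innerGuess B φ j (pre p t)) q :=
    (hinner.reindexWord (φ j)).strip hq
  have houter : Converges (fun t => outerOutput A B φ j (pre p t)) e :=
    (((converges_pre p).reindexWord _).applyWord hguess hr).map he
  refine ⟨b, hinner, m, hm, j, hj, e, houter, m', hm', i, hi, pairSeq q q', (q, y'),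
    (hguess.pairWord ((houter.reindexWord (ψ i)).strip hq')).stripsTo_emit, ⟨?_, ?_⟩,
    hdom, ⟨y, hy, hqy⟩, r, hr, x, hrx, hy'⟩
  · exact funext fun n => pairSeq_even q q' n
  · simpa only [pairSeq_odd] using hqy'

/-! ### A fixed number of guesses for the outer problem -/

theorem KGuessable.compProd {X : RepresentedSpace.{u}} {Y : RepresentedSpace.{v}}
    {Z : RepresentedSpace.{w}} {W : RepresentedSpace.{z}} {f : Problem X Y} {g : Problem Z W}
    {k l : ℕ} (hf : KGuessable k f) (hg : KGuessable l g) :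
    KGuessable (k * l) (compProd f g) := by
  obtain ⟨A, hA, hf⟩ := kGuessable_iff.1 hf
  obtain ⟨B, hB, hg⟩ := kGuessable_iff.1 hg
  have hpair : Computable₂ Nat.pair := Primrec₂.natPair.to_comp
  have hu : Computable fun x : List ℕ × ℕ => x.2.unpair := Computable.unpair.comp Computable.snd
  have hu₁ := Computable.fst.comp hu
  obtain ⟨C, hC, hev⟩ := exists_computable_eval (G := fun w n =>
    prodGuessEntry A B Nat.pair Nat.pair w (n.unpair.1 / k) (n.unpair.1 % k) n.unpair.2)
    (computable_prodGuessEntry hA hB hpair hpair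
      (Primrec.nat_div.to_comp.comp hu₁ (Computable.const k))
      (Primrec.nat_mod.to_comp.comp hu₁ (Computable.const k)) (Computable.snd.comp hu)
      Computable.fst)
  refine kGuessable_iff.2 ⟨C, hC, fun x hx p hp => ?_⟩
  obtain ⟨b, -, _, rfl, j, hj, e, -, _, rfl, i, hi, q, s, hq, hqs, hs⟩ := hf.compProd hg hx hp
  -- Guess number `n` stands for the pair `j = n / k`, `i = n % k`, that is, `n = i + k * j`.
  refine ⟨tuple fun n => prodGuessSeq A B Nat.pair Nat.pair p (n / k) (n % k),
    hev _ _ (fun t n v hv => ?_) (fun n => ?_), _, rfl, i + k * j, ?_, q, s, ?_, hqs, hs⟩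
  · rw [prodGuessEntry_pre] at hv
    split_ifs at hv
    exact (Option.some.inj hv).symm
  · filter_upwards [eventually_ge_atTop n.unpair.2] with t ht
    rw [prodGuessEntry_pre, if_pos ht]; rfl
  · calc i + k * j < k + k * j := by omega
      _ = k * (j + 1) := by ring
      _ ≤ k * l := Nat.mul_le_mul_left k hj
  · have h1 : (i + k * j) / k = j := by
      rw [Nat.add_mul_div_left _ _ (by omega), Nat.div_eq_of_lt hi, zero_add]
    have h2 : (i + k * j) % k = i := by rw [Nat.add_mul_mod_self_left, Nat.mod_eq_of_lt hi]
    simpa [tuple, h1, h2] using hq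

theorem FinitelyGuessable.compProd {X : RepresentedSpace.{u}} {Y : RepresentedSpace.{v}}
    {Z : RepresentedSpace.{w}} {W : RepresentedSpace.{z}} {f : Problem X Y} {g : Problem Z W}
    {k : ℕ} (hf : KGuessable k f) (hg : FinitelyGuessable g) :
    FinitelyGuessable (compProd f g) := by
  obtain ⟨A, hA, hf⟩ := kGuessable_iff.1 hf
  obtain ⟨B, hB, hg⟩ := finitelyGuessable_iff.1 hg
  have hpair : Computable₂ Nat.pair := Primrec₂.natPair.to_comp
  set φ : ℕ → ℕ → ℕ := fun j n => Nat.pair j n + 1 with hφ_def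
  have hφ : Computable₂ φ := Computable.succ.comp₂ hpair
  have hu : Computable fun x : (List ℕ × ℕ) × ℕ => x.2.unpair :=
    Computable.unpair.comp Computable.snd
  have hu₁ := Computable.fst.comp hu
  obtain ⟨C, hC, hev⟩ := exists_computable_eval (G := fun w n => Nat.casesOn n
    ((innerOutput B w)[0]?.map (k * ·)) fun n =>
      prodGuessEntry A B φ Nat.pair w (n.unpair.1 / k) (n.unpair.1 % k) n.unpair.2) <| by
    refine Computable.nat_casesOn (f := fun x : List ℕ × ℕ => x.2) Computable.snd
      (Computable.option_map (Computable.list_getElem?.comp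
        (computable_innerOutput hB Computable.fst) (Computable.const 0)) ?_) ?_
    · exact Primrec.nat_mul.to_comp.comp (Computable.const k) Computable.snd
    · exact computable_prodGuessEntry hA hB hφ hpair
        (Primrec.nat_div.to_comp.comp hu₁ (Computable.const k))
        (Primrec.nat_mod.to_comp.comp hu₁ (Computable.const k)) (Computable.snd.comp hu)
        (Computable.fst.comp Computable.fst)
  refine finitelyGuessable_iff.2 ⟨C, hC, fun x hx p hp => ?_⟩
  obtain ⟨b, hb, _, rfl, j, hj, e, -, _, rfl, i, hi, q, s, hq, hqs, hs⟩ := hf.compProd hg hx hp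
  -- The inner number of guesses is `b 0`, so the length `k * b 0` can be output without waiting for
  -- any outer computation.
  refine ⟨fun n => Nat.casesOn n (k * b 0)
    (tuple fun n => prodGuessSeq A B φ Nat.pair p (n / k) (n % k)),
    hev _ _ (fun t n v hv => ?_) (fun n => ?_), _, rfl, i + k * j, ?_, q, s, ?_, hqs, hs⟩
  · cases n with
    | zero =>
      obtain ⟨v', hv', rfl⟩ := Option.map_eq_some_iff.1 hv
      exact congrArg (k * ·) (hb.eq_of_getElem? hv')
    | succ n =>
      change prodGuessEntry A B φ Nat.pair _ _ _ _ = _ at hv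
      rw [prodGuessEntry_pre] at hv
      split_ifs at hv
      exact (Option.some.inj hv).symm
  · cases n with
    | zero =>
      filter_upwards [hb.eventually_getElem? 0] with t ht
      simp [ht]
    | succ n =>
      filter_upwards [eventually_ge_atTop n.unpair.2] with t ht
      rw [prodGuessEntry_pre, if_pos ht]; rfl
  · calc i + k * j < k + k * j := by omega
      _ = k * (j + 1) := by ring
      _ ≤ k * b 0 := Nat.mul_le_mul_left k hj
  · have h1 : (i + k * j) / k = j := by
      rw [Nat.add_mul_div_left _ _ (by omega), Nat.div_eq_of_lt hi, zero_add]
    have h2 : (i + k * j) % k = i := by rw [Nat.add_mul_mod_self_left, Nat.mod_eq_of_lt hi]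
    simpa [tuple, h1, h2] using hq

/-! ### An approximated number of guesses for both problems -/

/-- The first value that was found for the number of guesses for the outer problem after the `j`-th
guess for the inner one. -/
def outerCount (A B : Baire) (φ : ℕ → ℕ → ℕ) (j : ℕ) (w : List ℕ) : Option ℕ :=
  firstSome (fun s => (outerOutput A B φ j (w.take s))[0]?) (w.length + 1)

/-- A bound for the codes of the pairs `(j, i)` with `j` the first component of `m` and `i` less
than the number of guesses for the outer problem, if that number is already known and `j` is known
to be the number of a guess for the inner problem; zero otherwise. -/
def announce (A B : Baire) (φ : ℕ → ℕ → ℕ) (m : ℕ) (w : List ℕ) : ℕ :=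
  if ∃ v ∈ reindexWord (Nat.pair 0) (innerOutput B w), m.unpair.1 < v then
    ((outerCount A B φ m.unpair.1 w).map (Nat.pair m.unpair.1)).getD 0 else 0

theorem computable_announce {α : Type*} [Primcodable α] {A B : Baire} {φ : ℕ → ℕ → ℕ}
    {m : α → ℕ} {l : α → List ℕ} (hA : Computable A) (hB : Computable B) (hφ : Computable₂ φ)
    (hm : Computable m) (hl : Computable l) :
    Computable fun a => announce A B φ (m a) (l a) := by
  have hj : Computable fun a => (m a).unpair.1 :=
    Computable.fst.comp (Computable.unpair.comp hm)
  have hlt : PrimrecRel fun (v m : ℕ) => m < v := Primrec.nat_lt.comp₂ Primrec₂.right Primrec₂.left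
  have hr : Computable fun a => reindexWord (Nat.pair 0) (innerOutput B (l a)) :=
    Computable.reindexWord (φ := fun _ n => Nat.pair 0 n)
      (Primrec₂.natPair.to_comp.comp (Computable.const 0) Computable.snd)
      (computable_innerOutput hB hl)
  have hc : Computable fun a => outerCount A B φ (m a).unpair.1 (l a) := by
    refine Computable.firstSome ?_ (Computable.succ.comp (Computable.list_length.comp hl))
    exact Computable.list_getElem?.comp (computable_outerOutput hA hB hφ (hj.comp Computable.fst)
      (Primrec.list_take.to_comp.comp Computable.snd (hl.comp Computable.fst)))
      (Computable.const 0)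
  have h : Computable fun a =>
      bif decide (∃ v ∈ reindexWord (Nat.pair 0) (innerOutput B (l a)), (m a).unpair.1 < v) then
        ((outerCount A B φ (m a).unpair.1 (l a)).map (Nat.pair (m a).unpair.1)).getD 0 else 0 := by
    refine Computable.cond (hlt.exists_mem_list.decide.to_comp.comp hr hj)
      (Computable.option_getD (Computable.option_map hc ?_) (Computable.const 0))
      (Computable.const 0)
    exact Primrec₂.natPair.to_comp.comp (hj.comp Computable.fst) Computable.snd
  refine h.of_eq fun a => ?_
  rw [announce]
  split_ifs with hv <;> simp [hv]

theorem outerCount_stable {A B : Baire} {φ : ℕ → ℕ → ℕ} {j k s t : ℕ} {p : Baire} (h : s ≤ t)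
    (hk : outerCount A B φ j (pre p s) = some k) : outerCount A B φ j (pre p t) = some k := by
  rw [outerCount, pre_length] at hk ⊢
  refine firstSome_mono (Nat.succ_le_succ h) ?_
  rw [← hk]
  refine firstSome_congr fun i hi => ?_
  rw [take_pre (by omega), take_pre (by omega)]

/-- For a wrong `j` the words `outerOutput` need not be prefixes of one sequence. Keeping the first
value found still yields at most one count for each `j`. -/
theorem outerCount_unique {A B : Baire} {φ : ℕ → ℕ → ℕ} {j k k' s t : ℕ} {p : Baire}
    (hk : outerCount A B φ j (pre p s) = some k) (hk' : outerCount A B φ j (pre p t) = some k') :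
    k = k' := by
  have h := outerCount_stable (le_max_left s t) hk
  rw [outerCount_stable (le_max_right s t) hk'] at h
  exact (Option.some.inj h).symm

theorem eventually_outerCount {A B : Baire} {φ : ℕ → ℕ → ℕ} {j : ℕ} {p e : Baire}
    (h : Converges (fun t => outerOutput A B φ j (pre p t)) e) :
    ∀ᶠ t in atTop, outerCount A B φ j (pre p t) = some (e 0) := by
  obtain ⟨t₀, ht₀⟩ := (h.eventually_getElem? 0).exists
  filter_upwards [eventually_ge_atTop t₀] with t ht
  have : (outerCount A B φ j (pre p t)).isSome := by
    rw [outerCount, pre_length]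
    refine isSome_firstSome (s := t₀) (by omega) ?_
    rw [take_pre ht, ht₀]; rfl
  obtain ⟨k, hk⟩ := Option.isSome_iff_exists.1 this
  rw [hk]
  rw [outerCount, pre_length] at hk
  obtain ⟨s, hs, hsk⟩ := exists_of_firstSome hk
  rw [take_pre (by omega)] at hsk
  rw [h.eq_of_getElem? hsk]

/-- A nonzero announcement has the form `Nat.pair j k` with `j < N`, and `k` is determined by `j`.
-/
theorem announce_bddAbove {A B : Baire} {φ : ℕ → ℕ → ℕ} {p b : Baire} {N : ℕ}
    (hb : Converges (fun t => innerOutput B (pre p t)) b) (hN : ∀ n, comp b 0 n ≤ N) :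
    (Set.range fun m => announce A B φ m (pre p m)).Finite := by
  have key : (Set.range fun m => announce A B φ m (pre p m)) ⊆
      insert 0 ((fun j => Nat.pair j (Classical.epsilon fun k =>
        ∃ t, outerCount A B φ j (pre p t) = some k)) '' Set.Iio N) := by
    rintro _ ⟨m, rfl⟩
    dsimp only
    rw [announce]
    split_ifs with h
    · cases hk : outerCount A B φ m.unpair.1 (pre p m) with
      | none => simp
      | some k =>
        obtain ⟨v, hv, hjv⟩ := h
        obtain ⟨n, hn⟩ := List.mem_iff_getElem?.1 hv
        have hvn := (hb.reindexWord (Nat.pair 0)).eq_of_getElem? hn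
        refine Or.inr ⟨m.unpair.1, hjv.trans_le (hvn ▸ hN n), ?_⟩
        obtain ⟨t, ht⟩ := Classical.epsilon_spec
          (p := fun k => ∃ t, outerCount A B φ m.unpair.1 (pre p t) = some k) ⟨k, m, hk⟩
        dsimp only
        rw [outerCount_unique ht hk]
        rfl
    · exact Or.inl rfl
  exact (((Set.finite_Iio N).image _).insert 0).subset key

theorem exists_announce {A B : Baire} {φ : ℕ → ℕ → ℕ} {p b e : Baire} {j n : ℕ}
    (hb : Converges (fun t => innerOutput B (pre p t)) b) (hj : j < comp b 0 n)
    (he : Converges (fun t => outerOutput A B φ j (pre p t)) e) :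
    ∃ m, announce A B φ m (pre p m) = Nat.pair j (e 0) := by
  -- The stages `Nat.pair j t` are those reserved for `j`. There are arbitrarily late ones, so one
  -- of them comes after both `j` and its count have been recognized.
  have lim : Tendsto (Nat.pair j) atTop atTop :=
    tendsto_atTop_mono (fun n => Nat.right_le_pair j n) tendsto_id
  obtain ⟨t, ht, ht'⟩ := ((lim.eventually
    ((hb.reindexWord (Nat.pair 0)).eventually_getElem? n)).and
    (lim.eventually (eventually_outerCount he))).exists
  refine ⟨Nat.pair j t, ?_⟩
  rw [announce, if_pos ⟨_, List.mem_of_getElem? ht, by simpa [comp] using hj⟩]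
  simp [ht']

theorem EventuallyFinitelyGuessable.compProd {X : RepresentedSpace.{u}}
    {Y : RepresentedSpace.{v}} {Z : RepresentedSpace.{w}} {W : RepresentedSpace.{z}}
    {f : Problem X Y} {g : Problem Z W} (hf : FinitelyGuessable f)
    (hg : EventuallyFinitelyGuessable g) : EventuallyFinitelyGuessable (compProd f g) := by
  obtain ⟨A, hA, hf⟩ := finitelyGuessable_iff.1 hf
  obtain ⟨B, hB, hg⟩ := eventuallyFinitelyGuessable_iff.1 hg
  have hpair : Computable₂ Nat.pair := Primrec₂.natPair.to_comp
  set ψ : ℕ → ℕ → ℕ := fun j n => Nat.pair j n + 1 with hψ_def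
  have hψ : Computable₂ ψ := Computable.succ.comp₂ hpair
  set φ : ℕ → ℕ → ℕ := fun j n => Nat.pair (j + 1) n with hφ_def
  have hφ : Computable₂ φ := hpair.comp (Computable.succ.comp Computable.fst) Computable.snd
  -- Announcement number `m` looks at exactly the first `m` input entries, so it does not change
  -- when more input is known.
  obtain ⟨C, hC, hev⟩ := exists_computable_eval (G := fun w n => Nat.casesOn n.unpair.1
    (bif decide (n.unpair.2 ≤ w.length) then
      some (announce A B φ n.unpair.2 (w.take n.unpair.2)) else none)
    fun x => prodGuessEntry A B φ ψ w x.unpair.1 x.unpair.2 n.unpair.2) <| by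
    have hu : Computable fun x : List ℕ × ℕ => x.2.unpair := Computable.unpair.comp Computable.snd
    have hu₂ := Computable.snd.comp hu
    have hv : Computable fun x : (List ℕ × ℕ) × ℕ => x.2.unpair :=
      Computable.unpair.comp Computable.snd
    refine Computable.nat_casesOn (f := fun x : List ℕ × ℕ => x.2.unpair.1)
      (Computable.fst.comp hu) (Computable.cond (Primrec.nat_le.decide.to_comp.comp hu₂
        (Computable.list_length.comp Computable.fst)) (Computable.option_some.comp
          (computable_announce hA hB hφ hu₂ (Primrec.list_take.to_comp.comp hu₂ Computable.fst)))
        (Computable.const _)) ?_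
    exact computable_prodGuessEntry hA hB hφ hψ (Computable.fst.comp hv) (Computable.snd.comp hv)
        (hu₂.comp Computable.fst) (Computable.fst.comp Computable.fst)
  refine eventuallyFinitelyGuessable_iff.2 ⟨C, hC, fun x hx p hp => ?_⟩
  obtain ⟨b, hb, N, hN, j, hj, e, he, _, rfl, i, hi, q, s, hq, hqs, hs⟩ := hf.compProd hg hx hp
  obtain ⟨n, hn⟩ := hN.1
  have hfin := announce_bddAbove (A := A) (φ := φ) hb fun n => hN.2 ⟨n, rfl⟩
  obtain ⟨M, hM⟩ : ∃ M, IsGreatest (Set.range fun m => announce A B φ m (pre p m)) M := by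
    obtain ⟨M, hM, h⟩ := hfin.exists_maximal (Set.range_nonempty _)
    exact ⟨M, hM, fun y hy => (le_total y M).elim id fun hle => h hy hle⟩
  obtain ⟨m, hm⟩ := exists_announce hb (hn ▸ hj) he
  refine ⟨tuple fun n => Nat.casesOn n (fun m => announce A B φ m (pre p m))
    fun x => prodGuessSeq A B φ ψ p x.unpair.1 x.unpair.2,
    hev _ _ (fun t n v hv => ?_) (fun n => ?_), M, ?_, Nat.pair j i, ?_, q, s, ?_, hqs, hs⟩
  · unfold tuple
    cases hn : n.unpair.1 with
    | zero =>
      simp only [hn, pre_length] at hv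
      by_cases hle : n.unpair.2 ≤ t
      · simp only [hle, decide_true, cond_true, take_pre hle] at hv
        exact (Option.some.inj hv).symm
      · simp [hle] at hv
    | succ x =>
      simp only [hn, prodGuessEntry_pre] at hv
      split_ifs at hv
      exact (Option.some.inj hv).symm
  · filter_upwards [eventually_ge_atTop n.unpair.2] with t ht
    cases hn : n.unpair.1 with
    | zero => simp [pre_length, ht]
    | succ x => simp [prodGuessEntry_pre, ht]
  · dsimp only
    rw [comp_tuple]
    exact hM
  -- The pair `(j, i)` has guess number `Nat.pair j i`; announcing `Nat.pair j (e 0)` makes room for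
  -- all `i < e 0` by monotonicity of pairing.
  · calc Nat.pair j i < Nat.pair j (e 0) := Nat.pair_lt_pair_right j hi
      _ ≤ M := hm ▸ hM.2 ⟨m, rfl⟩
  · simpa [tuple] using hq

/-! ### Continuity arguments -/

theorem isOpen_pre_mem (A : Set (List ℕ)) (t : ℕ) : IsOpen {s : Baire | pre s t ∈ A} := by
  refine isOpen_iff_forall_mem_open.2 fun s hs =>
    ⟨PiNat.cylinder s t, fun s' hs' => ?_, PiNat.isOpen_cylinder _ s t, PiNat.self_mem_cylinder s t⟩
  have : pre s' t = pre s t := List.map_congr_left fun i hi => hs' i (List.mem_range.1 hi)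
  exact (congrArg (· ∈ A) this).mpr hs

/-- The sequence that agrees with `c` before `t` and is constantly `v` from there on. -/
def truncate (c : Baire) (v t : ℕ) : Baire := fun n => if n < t then c n else v

theorem tendsto_truncate (c : Baire) (v : ℕ) :
    Tendsto (truncate c v) atTop (nhds c) :=
  tendsto_pi_nhds.2 fun n => tendsto_nhds_of_eventually_eq <|
    (eventually_gt_atTop n).mono fun _ ht => if_pos ht

theorem eventually_truncate (c : Baire) (v t : ℕ) : ∀ᶠ n in atTop, truncate c v t n = v :=
  (eventually_ge_atTop t).mono fun _ hn => if_neg (not_lt.2 hn)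

theorem strip_append (l l' : List ℕ) : strip (l ++ l') = strip l ++ strip l' := by
  simp [strip]

theorem strip_prefix {l l' : List ℕ} (h : l <+: l') : strip l <+: strip l' := by
  obtain ⟨l'', rfl⟩ := h
  exact ⟨strip l'', (strip_append _ _).symm⟩

/-- From the stage `T` on, each further entry of `c` contributes exactly one `i` to the stripped
word. -/
theorem exists_stripsTo_of_eventually {c : Baire} {i : ℕ} (h : ∀ᶠ n in atTop, c n = i + 1) :
    ∃ q, StripsTo c q ∧ ∀ᶠ n in atTop, q n = i := by
  obtain ⟨T, hT⟩ := eventually_atTop.1 h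
  set l := strip (pre c T) with hl
  have key : ∀ m, strip (pre c (T + m)) = l ++ List.replicate m i := by
    intro m
    induction m with
    | zero => simp [hl]
    | succ m ih =>
      rw [← add_assoc, pre_succ, strip_append, ih, hT _ (by omega), List.replicate_succ']
      simp [strip]
  have hq : ∀ m n, n < l.length + m → (l ++ List.replicate m i)[n]? = some (l[n]?.getD i) := by
    intro m n hn
    by_cases hnl : n < l.length
    · rw [List.getElem?_append_left hnl]
      simp [hnl]
    · rw [List.getElem?_append_right (by omega), List.getElem?_eq_none (l := l) (by omega),
        List.getElem?_replicate, if_pos (by omega)]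
      rfl
  refine ⟨fun n => l[n]?.getD i, ⟨fun t => List.ext_getElem? fun n => ?_, ?_⟩, ?_⟩
  · have hp : strip (pre c t) <+: l ++ List.replicate t i := by
      rw [← key, ← take_pre (Nat.le_add_left t T)]
      exact strip_prefix (List.take_prefix _ _)
    rw [getElem?_pre]
    split_ifs with hn
    · rw [← hq t n (by simpa using hn.trans_le hp.length_le), List.prefix_iff_getElem?.1 hp n hn,
        List.getElem?_eq_getElem hn]
    · exact List.getElem?_eq_none (not_lt.1 hn)
  · refine tendsto_atTop.2 fun m => ?_
    filter_upwards [eventually_ge_atTop (T + m)] with t ht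
    obtain ⟨d, rfl⟩ := Nat.exists_eq_add_of_le ht
    rw [add_assoc, key]
    simp only [List.length_append, List.length_replicate]
    omega
  · filter_upwards [eventually_ge_atTop l.length] with n hn
    rw [List.getElem?_eq_none hn]; rfl

/-- Deleting zeros and decreasing the other entries by one turns some prefix of `s` into a word
whose entry with number `k` is `y`. -/
def StripEntry (k : ℕ) (s : Baire) (y : ℕ) : Prop := ∃ t, (strip (pre s t))[k]? = some y

theorem StripEntry.unique {k : ℕ} {s : Baire} {y y' : ℕ} (h : StripEntry k s y)
    (h' : StripEntry k s y') : y = y' := by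
  have mono : ∀ {t t' v}, t ≤ t' → (strip (pre s t))[k]? = some v →
      (strip (pre s t'))[k]? = some v := by
    intro t t' v htt hv
    rw [← take_pre htt] at hv
    obtain ⟨hk, rfl⟩ := List.getElem?_eq_some_iff.1 hv
    exact List.prefix_iff_getElem?.1 (strip_prefix (List.take_prefix t (pre s t'))) k hk
  obtain ⟨t, ht⟩ := h
  obtain ⟨t', ht'⟩ := h'
  have e := mono (le_max_left t t') ht
  rw [mono (le_max_right t t') ht'] at e
  exact (Option.some.inj e).symm

theorem StripsTo.stripEntry {s q : Baire} (h : StripsTo s q) (k : ℕ) : StripEntry k s (q k) :=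
  (Converges.eventually_getElem? h k).exists

/-- A finite prefix is a witness, since the rest of the stripped sequence does not matter. This is
why the continuity argument looks at a single entry. -/
theorem isOpen_stripEntry (k y : ℕ) : IsOpen {s : Baire | StripEntry k s y} := by
  have : {s : Baire | StripEntry k s y} =
      ⋃ t, {s : Baire | pre s t ∈ {l | (strip l)[k]? = some y}} := by
    ext s; simp [StripEntry]
  rw [this]
  exact isOpen_iUnion fun t => isOpen_pre_mem _ t

/-- On a nonempty open set, `L` continuous guesses are not enough to guess an arbitrary number
`i ≤ L` from the sequences with limit `i + 1`. -/
theorem exists_limit_not_guessed {L : ℕ} {G : ℕ → Baire → Baire} (hG : ∀ j, Continuous (G j))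
    (k : ℕ) {U : Set Baire} (hU : IsOpen U) (hne : U.Nonempty) :
    ∃ c ∈ U, ∃ i ≤ L, (∀ᶠ n in atTop, c n = i + 1) ∧
      ∀ j < L, ¬ StripEntry k (G j c) i := by
  classical
  by_contra! hcon
  -- `J V` collects the guesses that are already committed on all of `V`. An open `V` with as many
  -- committed guesses as possible leads to a contradiction.
  let J : Set Baire → Finset ℕ := fun V =>
    {j ∈ Finset.range L | ∃ y, ∀ c ∈ V, StripEntry k (G j c) y}
  have hJ : ∀ {V j}, j ∈ J V ↔ j < L ∧ ∃ y, ∀ c ∈ V, StripEntry k (G j c) y := by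
    simp [J]
  obtain ⟨V, ⟨hV, hVU, hVne⟩, hmax⟩ : ∃ V : Set Baire, (IsOpen V ∧ V ⊆ U ∧ V.Nonempty) ∧
      ∀ V' : Set Baire, IsOpen V' ∧ V' ⊆ U ∧ V'.Nonempty → (J V').card ≤ (J V).card := by
    have hfin : ((fun V => (J V).card) '' {V | IsOpen V ∧ V ⊆ U ∧ V.Nonempty}).Finite := by
      refine (Set.finite_Iic L).subset ?_
      rintro _ ⟨V, -, rfl⟩
      exact (Finset.card_filter_le _ _).trans (Finset.card_range L).le
    obtain ⟨_, ⟨V, hV, rfl⟩, h⟩ := hfin.exists_maximal ⟨_, U, ⟨hU, subset_rfl, hne⟩, rfl⟩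
    exact ⟨V, hV, fun V' hV' => (le_total (J V').card (J V).card).elim id
      fun hle => h ⟨V', hV', rfl⟩ hle⟩
  obtain ⟨c₀, hc₀⟩ := hVne
  let val : ℕ → ℕ := fun j => Classical.epsilon fun y => StripEntry k (G j c₀) y
  -- At most `L` committed values face `L + 1` candidates, so some `i ≤ L` is not among them.
  -- Continuing a long prefix of `c₀` by `i + 1` stays in `V` and forces a guess `j` to have the
  -- value `i`.
  have hcard : ((J V).image val).card < (Finset.range (L + 1)).card := by
    rw [Finset.card_range]
    exact Nat.lt_succ_of_le (Finset.card_image_le.trans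
      ((Finset.card_filter_le _ _).trans (Finset.card_range L).le))
  obtain ⟨i, hi, hiJ⟩ := Finset.exists_mem_notMem_of_card_lt_card hcard
  obtain ⟨t, ht⟩ := ((tendsto_truncate c₀ (i + 1)).eventually (hV.mem_nhds hc₀)).exists
  obtain ⟨j, hj, hji⟩ := hcon _ (hVU ht) i (Nat.lt_succ_iff.1 (Finset.mem_range.1 hi))
    (eventually_truncate c₀ (i + 1) t)
  have hjV : j ∉ J V := fun h => by
    obtain ⟨-, y, hy⟩ := hJ.1 h
    refine hiJ (Finset.mem_image.2 ⟨j, h, ?_⟩)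
    exact (Classical.epsilon_spec (p := fun y => StripEntry k (G j c₀) y) ⟨y, hy _ hc₀⟩).unique
      (hji.unique (hy _ ht) ▸ hy _ hc₀)
  -- Guess `j` was not committed on `V`, but it is on this smaller open set, which contradicts
  -- maximality.
  let V' := V ∩ {c | StripEntry k (G j c) i}
  have hsub : insert j (J V) ⊆ J V' := by
    intro j' hj'
    rcases Finset.mem_insert.1 hj' with rfl | h
    · exact hJ.2 ⟨hj, i, fun c hc => hc.2⟩
    · obtain ⟨hl, y, hy⟩ := hJ.1 h
      exact hJ.2 ⟨hl, y, fun c hc => hy c hc.1⟩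
  have := (Finset.card_le_card hsub).trans (hmax V' ⟨hV.inter
    ((isOpen_stripEntry k i).preimage (hG j)), Set.inter_subset_left.trans hVU, _, ht, hji⟩)
  rw [Finset.card_insert_of_notMem hjV] at this
  omega

/-! ### Problems whose composition needs too many guesses -/

/-- The natural numbers, represented by the zeroth entry of a name. -/
def natSpace : RepresentedSpace.{0} where
  carrier := ℕ
  Names p n := p 0 = n
  functional h h' := h.symm.trans h'
  surjective n := ⟨fun _ => n, rfl⟩

/-- The natural numbers, where a name of `i` is a sequence that is eventually constantly `i`. -/
def limSpace : RepresentedSpace.{0} where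
  carrier := ℕ
  Names p i := ∀ᶠ n in atTop, p n = i
  functional h h' := by
    obtain ⟨n, hn, hn'⟩ := (h.and h').exists
    exact hn.symm.trans hn'
  surjective i := ⟨fun _ => i, Eventually.of_forall fun _ => rfl⟩

/-- The natural numbers, where a name of `i` is a sequence that is eventually constantly `i` and
starts with a bound for `i`. -/
def boundedLimSpace : RepresentedSpace.{0} where
  carrier := ℕ
  Names p i := (∀ᶠ n in atTop, p n = i) ∧ i ≤ p 0
  functional h h' := limSpace.functional h.1 h'.1
  surjective i := ⟨fun _ => i, Eventually.of_forall fun _ => rfl, le_rfl⟩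

/-- Find the limit of an eventually constant sequence. -/
def limProblem : Problem limSpace natSpace := fun (i : ℕ) => ({i} : Set ℕ)

/-- Find the limit of an eventually constant sequence, given a bound. -/
def boundedLimProblem : Problem boundedLimSpace natSpace := fun (i : ℕ) => ({i} : Set ℕ)

/-- Map a point of the completion to itself and bottom to a given point. -/
def extractProblem (X : RepresentedSpace.{u}) (x₀ : X.carrier) : Problem X.completion X :=
  fun x : Option X.carrier => {x.getD x₀}

/-! ### Guessability of the example problems -/

/-- The first guess copies the input, which is right unless it names bottom; the second is the
default `x₀`, which is right for bottom. -/
theorem kGuessable_two_extractProblem {X : RepresentedSpace.{u}} {x₀ : X.carrier} {q₀ : Baire}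
    (h₀ : Computable q₀) (hq₀ : X.Names q₀ x₀) : KGuessable 2 (extractProblem X x₀) := by
  obtain ⟨C, hC, hev⟩ := exists_computable_eval (G := fun w n =>
    Nat.casesOn n.unpair.1 w[n.unpair.2]? fun _ => some (q₀ n.unpair.2 + 1)) <| by
    have hu : Computable fun x : List ℕ × ℕ => x.2.unpair := Computable.unpair.comp Computable.snd
    have hu₂ := Computable.snd.comp hu
    refine Computable.nat_casesOn (f := fun x : List ℕ × ℕ => x.2.unpair.1)
      (Computable.fst.comp hu) (Computable.list_getElem?.comp Computable.fst hu₂) ?_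
    exact Computable.option_some.comp
      (Computable.succ.comp (h₀.comp (hu₂.comp Computable.fst)))
  refine kGuessable_iff.2 ⟨C, hC, fun x _ p hp => ?_⟩
  refine ⟨fun n => Nat.casesOn n.unpair.1 (p n.unpair.2) fun _ => q₀ n.unpair.2 + 1,
    hev _ _ (fun t n v hv => ?_) (fun n => ?_), 2, rfl, ?_⟩
  · dsimp only at hv ⊢
    cases hn : n.unpair.1 with
    | zero =>
      rw [hn] at hv
      exact (converges_pre p).eq_of_getElem? hv
    | succ m =>
      rw [hn] at hv
      exact (Option.some.inj hv).symm
  · filter_upwards [(converges_pre p).eventually_getElem? n.unpair.2] with t ht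
    rw [ht]
    cases n.unpair.1 <;> rfl
  · match x, hp with
    | some x, hp =>
      obtain ⟨q, hq, hqx⟩ := hp
      exact ⟨0, by omega, q, x, by simpa using hq, hqx, rfl⟩
    | none, _ => exact ⟨1, by omega, q₀, x₀, by simpa using stripsTo_succ q₀, hq₀, rfl⟩

/-- The first entry `p 0` bounds the limit, so the constants `0, …, p 0` suffice. -/
theorem finitelyGuessable_boundedLimProblem : FinitelyGuessable boundedLimProblem := by
  obtain ⟨C, hC, hev⟩ := exists_computable_eval (G := fun w n =>
    Nat.casesOn n (w[0]?.map Nat.succ) fun n => some (n.unpair.1 + 1)) <| by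
    refine Computable.nat_casesOn (f := fun x : List ℕ × ℕ => x.2) Computable.snd
      (Computable.option_map (Computable.list_getElem?.comp Computable.fst (Computable.const 0))
        (Computable.succ.comp Computable.snd).to₂) ?_
    exact Computable.option_some.comp (Computable.succ.comp
      (Computable.fst.comp (Computable.unpair.comp Computable.snd)))
  refine finitelyGuessable_iff.2 ⟨C, hC, fun (i : ℕ) _ p hp => ?_⟩
  refine ⟨fun n => Nat.casesOn n (p 0 + 1) fun n => n.unpair.1 + 1,
    hev _ _ (fun t n v hv => ?_) (fun n => ?_), p 0 + 1, rfl, i, Nat.lt_succ_of_le hp.2,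
    fun _ => i, i, ?_, rfl, rfl⟩
  · cases n with
    | zero =>
      obtain ⟨v', hv', rfl⟩ := Option.map_eq_some_iff.1 hv
      exact congrArg Nat.succ ((converges_pre p).eq_of_getElem? hv')
    | succ n => exact (Option.some.inj hv).symm
  · filter_upwards [(converges_pre p).eventually_getElem? 0] with t ht
    rw [ht]
    cases n <;> rfl
  · simpa only [Nat.unpair_pair] using stripsTo_succ fun _ => i

/-- Guess number `i` is the constant `i`, and reading `p n` raises the announced number to at least
`p n + 1`. An eventually constant `p` has finitely many values, so a maximum exists, and it exceeds
the limit. -/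
theorem eventuallyFinitelyGuessable_limProblem : EventuallyFinitelyGuessable limProblem := by
  obtain ⟨C, hC, hev⟩ := exists_computable_eval (G := fun w n =>
    Nat.casesOn n.unpair.1 (w[n.unpair.2]?.map Nat.succ) fun i => some (i + 1)) <| by
    have hu : Computable fun x : List ℕ × ℕ => x.2.unpair := Computable.unpair.comp Computable.snd
    refine Computable.nat_casesOn (f := fun x : List ℕ × ℕ => x.2.unpair.1)
      (Computable.fst.comp hu) (Computable.option_map
        (Computable.list_getElem?.comp Computable.fst (Computable.snd.comp hu))
        (Computable.succ.comp Computable.snd).to₂) ?_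
    exact Computable.option_some.comp (Computable.succ.comp Computable.snd)
  refine eventuallyFinitelyGuessable_iff.2 ⟨C, hC, fun (i : ℕ) _ p hp => ?_⟩
  obtain ⟨T, hT⟩ := eventually_atTop.1 hp
  have hfin : (Set.range fun n => p n + 1).Finite := by
    refine (((Set.finite_Iio T).image fun n => p n + 1).insert (i + 1)).subset ?_
    rintro _ ⟨n, rfl⟩
    by_cases hn : n < T
    · exact Or.inr ⟨n, hn, rfl⟩
    · exact Or.inl (congrArg Nat.succ (hT n (not_lt.1 hn)))
  obtain ⟨M, hM⟩ : ∃ M, IsGreatest (Set.range fun n => p n + 1) M := by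
    obtain ⟨M, hM, h⟩ := hfin.exists_maximal (Set.range_nonempty _)
    exact ⟨M, hM, fun y hy => (le_total y M).elim id fun hle => h hy hle⟩
  refine ⟨fun n => Nat.casesOn n.unpair.1 (p n.unpair.2 + 1) fun i => i + 1,
    hev _ _ (fun t n v hv => ?_) (fun n => ?_), M, ?_, i, ?_, fun _ => i, i, ?_, rfl, rfl⟩
  · dsimp only at hv ⊢
    cases hn : n.unpair.1 with
    | zero =>
      rw [hn] at hv
      obtain ⟨v', hv', rfl⟩ := Option.map_eq_some_iff.1 hv
      exact congrArg Nat.succ ((converges_pre p).eq_of_getElem? hv')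
    | succ m =>
      rw [hn] at hv
      exact (Option.some.inj hv).symm
  · filter_upwards [(converges_pre p).eventually_getElem? n.unpair.2] with t ht
    rw [ht]
    cases n.unpair.1 <;> rfl
  · convert hM using 3 with n
    simp [comp]
  · exact Nat.lt_of_succ_le (hM.2 ⟨T, congrArg Nat.succ (hT T le_rfl)⟩)
  · simpa only [Nat.unpair_pair] using stripsTo_succ fun _ => i

/-! ### Failure of guessability for the compositions -/

theorem wordFun_id (l : List ℕ) : wordFun id l = l := by simp [wordFun]

theorem eval_id (p : Baire) : Eval id p p := by
  simpa only [Eval, wordFun_id] using converges_pre p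

theorem pre_pairSeq_congr {p q q' : Baire} {t : ℕ} (h : ∀ n < t, q n = q' n) :
    pre (pairSeq p q) t = pre (pairSeq p q') t := by
  refine List.map_congr_left fun n hn => ?_
  have : n.div2 ≤ n := by rw [Nat.div2_val]; omega
  simp only [pairSeq, h _ (this.trans_lt (List.mem_range.1 hn))]

/-- Guesses for the composition of `f` with `extractProblem` yield a continuous function that
guesses solutions of `f` at the points named by the stripped input, where the input may be any
sequence. -/
theorem GuessesBy.exists_continuous {X : RepresentedSpace.{u}} {f : Problem X natSpace}
    {x₀ : X.carrier} {L : Baire → ℕ → Prop} {ψ : ℕ → ℕ → ℕ} {C : Baire}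
    (hf : ∀ x, (f x).Nonempty) (h : GuessesBy L ψ C (Weihrauch.compProd f (extractProblem X x₀))) :
    ∃ G : Baire → Baire, Continuous G ∧ ∀ c, ∃ m, L (G c) m ∧ ∀ q x, StripsTo c q →
      X.Names q x → ∃ i < m, ∃ v : ℕ, StripEntry 1 (fun n => G c (ψ i n)) v ∧ v ∈ f x := by
  have key : ∀ c, ∃ r, Eval C (pairSeq id c) r ∧ ∃ m, L r m ∧ ∀ q x, StripsTo c q →
      X.Names q x → ∃ i < m, ∃ v : ℕ, StripEntry 1 (fun n => r (ψ i n)) v ∧ v ∈ f x := by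
    intro c
    obtain ⟨y, hy⟩ := completion_names_total X c
    -- The code `id` gives the identity function, and `f` is total, so this is an instance whatever
    -- `c` names, even bottom.
    have hdom : ((id, y) : Baire × Option X.carrier) ∈
        (Weihrauch.compProd f (extractProblem X x₀)).dom := by
      obtain ⟨q, hq⟩ := X.surjective (Option.getD y x₀)
      obtain ⟨v, hv⟩ := hf (Option.getD y x₀)
      exact ⟨(q, v), fun b _ q hq => ⟨q, eval_id q, b, hf b, hq⟩, ⟨_, rfl, hq⟩, q, eval_id q,
        _, hq, hv⟩
    obtain ⟨r, hr, m, hm, i, hi, q, ⟨q', v⟩, hq, ⟨-, hqv⟩, -, ⟨_, rfl, hb⟩, q'', hq'', x', hx', hv⟩ :=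
      h (id, y) hdom (pairSeq id c)
        ⟨funext fun n => pairSeq_even _ _ n, by simpa only [pairSeq_odd] using hy⟩
    refine ⟨r, hr, m, hm, fun q₁ x hq₁ hx => ⟨i, hi, v, ?_, ?_⟩⟩
    -- The second component of a solution occupies the odd entries, and `natSpace` reads its zeroth
    -- one; hence entry `1`.
    · have hqv : q 1 = v := hqv
      exact hqv ▸ hq.stripEntry 1
    · obtain rfl : y = some x := X.completion.functional hy ⟨q₁, hq₁, hx⟩
      obtain rfl := Eval.unique hq'' (eval_id q')
      obtain rfl := X.functional hx' hb
      exact hv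
  choose G hG hG' using key
  refine ⟨G, continuous_pi fun n => IsLocallyConstant.continuous ?_, hG'⟩
  refine (IsLocallyConstant.iff_exists_open _).2 fun c => ?_
  obtain ⟨t, ht⟩ := (Converges.eventually_getElem? (hG c) n).exists
  refine ⟨PiNat.cylinder c t, PiNat.isOpen_cylinder _ c t, PiNat.self_mem_cylinder c t,
    fun c' hc' => ?_⟩
  rw [pre_pairSeq_congr (q' := c') fun m hm => (hc' m hm).symm] at ht
  exact (Converges.eq_of_getElem? (hG c') ht).symm

theorem not_finitelyGuessable_compProd_boundedLimProblem :
    ¬ FinitelyGuessable (compProd boundedLimProblem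
      (extractProblem boundedLimSpace (0 : ℕ))) := by
  intro h
  obtain ⟨C, -, h⟩ := finitelyGuessable_iff.1 h
  obtain ⟨G, hG, hguess⟩ := h.exists_continuous fun i : ℕ => Set.singleton_nonempty i
  -- Entry `0` is the number of guesses. On the zero sequence, which names bottom, the guesser must
  -- still fix it, and by continuity some prefix of zeros decides it.
  set L := G (fun _ => 0) 0 with hL
  have hU : IsOpen {c | G c 0 = L} :=
    (isOpen_discrete {L}).preimage ((continuous_apply 0).comp hG)
  obtain ⟨t, ht⟩ := ((tendsto_truncate (fun _ => 0) (L + 1)).eventually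
    (hU.mem_nhds hL.symm)).exists
  obtain ⟨c, ⟨hcU, hct⟩, i, hi, hci, hnot⟩ := exists_limit_not_guessed (L := L)
    (G := fun j c n => G c (Nat.pair j n + 1))
    (fun j => continuous_pi fun n => (continuous_apply _).comp hG) 1
    (hU.inter (PiNat.isOpen_cylinder _ (truncate (fun _ => 0) (L + 1) t) (t + 1)))
    ⟨_, ht, PiNat.self_mem_cylinder _ _⟩
  obtain ⟨q, hq, hqi⟩ := exists_stripsTo_of_eventually hci
  -- In the chosen cylinder `c` starts with `t` zeros and then `L + 1`, which strips to the bound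
  -- `L`. This bound admits all `L + 1` candidates.
  have hq0 : L = q 0 := by
    refine Converges.eq_of_getElem? hq (t := t + 1) ?_
    have h1 : pre c t = List.replicate t 0 := List.eq_replicate_iff.2 ⟨pre_length c t, by
      intro v hv
      obtain ⟨n, hn, rfl⟩ := List.mem_map.1 hv
      have hn := List.mem_range.1 hn
      rw [hct n (by omega), truncate, if_pos hn]⟩
    have h2 : c t = L + 1 := by rw [hct t t.lt_succ_self, truncate, if_neg (lt_irrefl t)]
    rw [pre_succ, h1, h2]
    simp [strip]
  obtain ⟨m, hm, hc⟩ := hguess c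
  obtain ⟨j, hj, v, hv, hvi⟩ := hc q i hq ⟨hqi, hq0 ▸ hi⟩
  obtain rfl : v = i := hvi
  exact hnot j (hj.trans_eq (hm.symm.trans hcU)) hv

theorem not_eventuallyFinitelyGuessable_compProd_limProblem :
    ¬ EventuallyFinitelyGuessable (compProd limProblem (extractProblem limSpace (0 : ℕ))) := by
  intro h
  obtain ⟨C, -, h⟩ := eventuallyFinitelyGuessable_iff.1 h
  obtain ⟨G, hG, hguess⟩ := h.exists_continuous fun i : ℕ => Set.singleton_nonempty i
  have hclosed : ∀ L, IsClosed {c | ∀ n, comp (G c) 0 n ≤ L} := fun L => by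
    rw [Set.ofPred_forall]
    exact isClosed_iInter fun n => isClosed_le ((continuous_apply _).comp hG) continuous_const
  have hcover : ⋃ L, {c | ∀ n, comp (G c) 0 n ≤ L} = Set.univ := by
    refine Set.eq_univ_of_forall fun c => ?_
    obtain ⟨m, hm, -⟩ := hguess c
    exact Set.mem_iUnion.2 ⟨m, fun n => hm.2 ⟨n, rfl⟩⟩
  -- Baire category: each `c` has a finite number of guesses, so the closed sets where it is at most
  -- `L` cover the space.
  obtain ⟨L, hL⟩ := nonempty_interior_of_iUnion_of_closed hclosed hcover
  obtain ⟨c, hcU, i, hi, hci, hnot⟩ := exists_limit_not_guessed (L := L)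
    (G := fun j c n => G c (Nat.pair (j + 1) n))
    (fun j => continuous_pi fun n => (continuous_apply _).comp hG) 1 isOpen_interior hL
  obtain ⟨q, hq, hqi⟩ := exists_stripsTo_of_eventually hci
  obtain ⟨m, hm, hc⟩ := hguess c
  obtain ⟨j, hj, v, hv, hvi⟩ := hc q i hq hqi
  obtain rfl : v = i := hvi
  obtain ⟨n, hn⟩ := hm.1
  exact hnot j (hj.trans_le (hn ▸ interior_subset hcU n)) hv

end Weihrauch

theorem proposition9 :
    (∀ {X : RepresentedSpace.{u}} {Y : RepresentedSpace.{v}} {Z : RepresentedSpace.{w}}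
        {W : RepresentedSpace.{z}} (f : Problem X Y) (g : Problem Z W),
      (∀ k l : ℕ, KGuessable k f → KGuessable l g → KGuessable (k * l) (compProd f g)) ∧
      ((∃ k : ℕ, KGuessable k f) → FinitelyGuessable g → FinitelyGuessable (compProd f g)) ∧
      (FinitelyGuessable f → EventuallyFinitelyGuessable g →
        EventuallyFinitelyGuessable (compProd f g))) ∧
    (∃ (X Y Z W : RepresentedSpace.{0}) (f : Problem X Y) (g : Problem Z W),
      FinitelyGuessable f ∧ KGuessable 2 g ∧ ¬ FinitelyGuessable (compProd f g)) ∧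
    (∃ (X Y Z W : RepresentedSpace.{0}) (f : Problem X Y) (g : Problem Z W),
      EventuallyFinitelyGuessable f ∧ KGuessable 2 g ∧
        ¬ EventuallyFinitelyGuessable (compProd f g)) := by
  refine ⟨fun f g => ⟨fun k l => KGuessable.compProd, ?_, EventuallyFinitelyGuessable.compProd⟩,
    ?_, ?_⟩
  · rintro ⟨k, hf⟩
    exact FinitelyGuessable.compProd hf
  · exact ⟨_, _, _, _, boundedLimProblem, extractProblem boundedLimSpace (0 : ℕ),
      finitelyGuessable_boundedLimProblem, kGuessable_two_extractProblem (Computable.const 0)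
        ⟨Eventually.of_forall fun _ => rfl, le_rfl⟩,
      not_finitelyGuessable_compProd_boundedLimProblem⟩
  · exact ⟨_, _, _, _, limProblem, extractProblem limSpace (0 : ℕ),
      eventuallyFinitelyGuessable_limProblem, kGuessable_two_extractProblem (Computable.const 0)
        (Eventually.of_forall fun _ => rfl),
      not_eventuallyFinitelyGuessable_compProd_limProblem⟩
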